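/- Let $M$ be a smooth (finite-dimensional, Hausdorff) manifold, $F\subseteq TM$ a sub vector bundle and $\phi:TM\to F$ a smooth fibrewise linear projection onto $F$ (a connection for $F$); put $h:=\mathrm{Id}_{TM}-\phi$. Let $h^*:\Omega(M)\to\Omega(M)$ be $(h^*\omega)(X_1,\dots,X_p)=\omega(hX_1,\dots,hX_p)$. A linear map $D:\Omega(M)\to\Omega(M)$ is a derivation over $h^*$ of degree $k\in\mathbb Z$ if $D(\Omega^q(M))\subseteq\Omega^{q+k}(M)$ and $D(\alpha\wedge\beta)=D\alpha\wedge h^*\beta+(-1)^{kq}\,h^*\alpha\wedge D\beta$ for all $\alpha\in\Omega^q(M)$, $\beta\in\Omega(M)$; it is algebraic if $D|\Omega^0(M)=0$. Let $\mathrm{Der}^h_k\Omega(M)$ be the space of derivations over $h^*$ of degree $k$ which commute with $h^*$. Forms of negative degree are $0$; $k,l$ denote integers. **1.** For every algebraic derivation $D$ over $h^*$ of degree $k$ there is a unique $K\in\Omega^{k+1}(M;TM)$ with $D\omega=\omega\circ K$ for all $\omega\in\Omega^1(M)$. Conversely, for every $K\in\Omega^{k+1}(M;TM)$ there is exactly one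 algebraic derivation over $h^*$ of degree $k$ with $D\omega=\omega\circ K$ for all $\omega\in\Omega^1(M)$. It is denoted $i^h(K)$; it vanishes on $\Omega^0(M)$, and for $\omega\in\Omega^p(M)$ with $p\ge1$ and $k\ge -1$ it is given by $$(i^h(K)\omega)(X_1,\dots,X_{k+p})=\frac1{(k+1)!\,(p-1)!}\sum_{\sigma\in S_{k+p}}\varepsilon(\sigma)\,\omega\bigl(K(X_{\sigma1},\dots,X_{\sigma(k+1)}),hX_{\sigma(k+2)},\dots,hX_{\sigma(k+p)}\bigr).$$ **2.** For $K\in\Omega^{k+1}(M;TM)$ we have $[i^h(K),h^*]:=i^h(K)\circ h^*-h^*\circ i^h(K)=0$ if and only if $h\circ K=K\circ\Lambda^{k+1}h$. Let $\Omega^{k+1}(M;TM)^h$ denote the space of all such $K$. **3.** Let $i^h(K)$ act on $\Omega(M;TM)$ by the same formula (and by $0$ on $\Omega^0(M;TM)$). For $K\in\Omega^{k+1}(M;TM)^h$ and $L\in\Omega^{l+1}(M;TM)^h$ the form $$[K,L]^{\wedge,h}:=i^h(K)L-(-1)^{kl}\,i^h(L)K$$ lies in $\Omega^{k+l+1}(M;TM)^h$.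 This bracket makes $\bigoplus_k\Omega^{k+1}(M;TM)^h$, with $\Omega^{k+1}(M;TM)^h$ in degree $k$, a graded Lie algebra, and $$i^h([K,L]^{\wedge,h})=[i^h(K),i^h(L)]:=i^h(K)\circ i^h(L)-(-1)^{kl}\,i^h(L)\circ i^h(K)$$ in $\mathrm{Der}^h_{k+l}\Omega(M)$, where $i^h(K)\in\mathrm{Der}^h_k\Omega(M)$ and $i^h(L)\in\mathrm{Der}^h_l\Omega(M)$. **4.** For $K\in\Omega^{k+1}(M;TM)$ let $i(K)$ be the usual insertion operator on $\Omega(M)$ (the formula in 1 with $h$ replaced by $\mathrm{Id}_{TM}$, and $0$ on $\Omega^0(M)$). Then $$\begin{aligned} &h^*\circ i(K)=i^h(K\circ\Lambda^{k+1}h)=h^*\circ i^h(K),\\ &i(K)\circ h^*=i^h(h\circ K)=i^h(K)\circ h^*,\\ &[i(K),h^*]=[i^h(K),h^*]=i^h(h\circ K-K\circ\Lambda^{k+1}h),\\ &h^*\circ i(K)\circ h^*=h^*\circ i^h(K)\circ h^*=i^h(h\circ K\circ\Lambda^{k+1}h). \end{aligned}$$ -/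

import Mathlib

open scoped Manifold ContDiff DirectSum
open Bundle

namespace HDer

noncomputable section

/-! ## Multilinear algebra on one vector space -/

section Pointwise

variable {T W : Type*} [AddCommGroup T] [Module ℝ T] [AddCommGroup W] [Module ℝ W]

/-- The multilinear map `(X₁, …, X_{m+q}) ↦ α (K (X₁, …, X_m), g X_{m+1}, …, g X_{m+q})`. -/
def preIns (g : T →ₗ[ℝ] T) {m q : ℕ} (K : T [⋀^Fin m]→ₗ[ℝ] T)
    (α : T [⋀^Fin (q + 1)]→ₗ[ℝ] W) : MultilinearMap ℝ (fun _ : Fin (m + q) => T) W :=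
  (MultilinearMap.uncurrySum (R := ℝ) (N := fun _ : Fin m ⊕ Fin q => T)
    (((MultilinearMap.compLinearMapₗ (fun _ : Fin q => g)).comp
      α.toMultilinearMap.curryLeft).compMultilinearMap K.toMultilinearMap)).domDomCongr
    finSumFinEquiv

theorem preIns_apply (g : T →ₗ[ℝ] T) {m q : ℕ} (K : T [⋀^Fin m]→ₗ[ℝ] T)
    (α : T [⋀^Fin (q + 1)]→ₗ[ℝ] W) (X : Fin (m + q) → T) :
    preIns g K α X = α (Fin.cons (K fun i => X (Fin.castAdd q i))
      fun j => g (X (Fin.natAdd m j))) := by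
  simp [preIns]

/-- The alternating `(m+q)`-linear map
`1/(m! q!) ∑_σ ε(σ) α (K (X_{σ1}, …, X_{σm}), g X_{σ(m+1)}, …, g X_{σ(m+q)})`. -/
def insAlt (g : T →ₗ[ℝ] T) {m q : ℕ} (K : T [⋀^Fin m]→ₗ[ℝ] T)
    (α : T [⋀^Fin (q + 1)]→ₗ[ℝ] W) : T [⋀^Fin (m + q)]→ₗ[ℝ] W :=
  ((1 : ℝ) / (m.factorial * q.factorial)) • MultilinearMap.alternatization (preIns g K α)

theorem insAlt_apply (g : T →ₗ[ℝ] T) {m q : ℕ} (K : T [⋀^Fin m]→ₗ[ℝ] T)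
    (α : T [⋀^Fin (q + 1)]→ₗ[ℝ] W) (X : Fin (m + q) → T) :
    insAlt g K α X = ((1 : ℝ) / (m.factorial * q.factorial)) •
      ∑ σ : Equiv.Perm (Fin (m + q)), ((Equiv.Perm.sign σ : ℤ) : ℝ) •
        α (Fin.cons (K fun i => X (σ (Fin.castAdd q i)))
          fun j => g (X (σ (Fin.natAdd m j)))) := by
  simp only [insAlt, AlternatingMap.smul_apply, MultilinearMap.alternatization_apply,
    MultilinearMap.domDomCongr_apply, preIns_apply, Units.smul_def, Int.cast_smul_eq_zsmul]

theorem insAlt_add_left (g : T →ₗ[ℝ] T) {m q : ℕ} (K K' : T [⋀^Fin m]→ₗ[ℝ] T)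
    (α : T [⋀^Fin (q + 1)]→ₗ[ℝ] W) : insAlt g (K + K') α = insAlt g K α + insAlt g K' α := by
  have h : preIns g (K + K') α = preIns g K α + preIns g K' α := by
    ext X
    simp only [preIns_apply, add_apply, AlternatingMap.add_apply]
    exact α.toMultilinearMap.cons_add _ _ _
  simp only [insAlt, h, map_add, smul_add]

theorem insAlt_smul_left (g : T →ₗ[ℝ] T) {m q : ℕ} (c : ℝ) (K : T [⋀^Fin m]→ₗ[ℝ] T)
    (α : T [⋀^Fin (q + 1)]→ₗ[ℝ] W) : insAlt g (c • K) α = c • insAlt g K α := by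
  ext X
  have h : ∀ (a : T) (v : Fin q → T), α (Fin.cons (c • a) v) = c • α (Fin.cons a v) :=
    fun a v => α.toMultilinearMap.cons_smul _ _ _
  simp only [insAlt_apply, AlternatingMap.smul_apply, h, Finset.smul_sum]
  exact Finset.sum_congr rfl fun σ _ => by simp only [smul_smul]; ring_nf

theorem insAlt_add_right (g : T →ₗ[ℝ] T) {m q : ℕ} (K : T [⋀^Fin m]→ₗ[ℝ] T)
    (α β : T [⋀^Fin (q + 1)]→ₗ[ℝ] W) : insAlt g K (α + β) = insAlt g K α + insAlt g K β := by
  ext X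
  simp only [insAlt_apply, AlternatingMap.add_apply, smul_add, Finset.sum_add_distrib]

theorem insAlt_smul_right (g : T →ₗ[ℝ] T) {m q : ℕ} (c : ℝ) (K : T [⋀^Fin m]→ₗ[ℝ] T)
    (α : T [⋀^Fin (q + 1)]→ₗ[ℝ] W) : insAlt g K (c • α) = c • insAlt g K α := by
  ext X
  simp only [insAlt_apply, AlternatingMap.smul_apply, Finset.smul_sum]
  exact Finset.sum_congr rfl fun σ _ => by simp only [smul_smul]; ring_nf

/-- The wedge product
`(α ∧ η)(X) = 1/(p! q!) ∑_σ ε(σ) α (X_{σ1}, …, X_{σp}) η (X_{σ(p+1)}, …, X_{σ(p+q)})`. -/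
def wedgeAlt {p q : ℕ} (α : T [⋀^Fin p]→ₗ[ℝ] ℝ) (η : T [⋀^Fin q]→ₗ[ℝ] ℝ) :
    T [⋀^Fin (p + q)]→ₗ[ℝ] ℝ :=
  ((1 : ℝ) / (p.factorial * q.factorial)) • MultilinearMap.alternatization
    ((MultilinearMap.uncurrySum (R := ℝ) (N := fun _ : Fin p ⊕ Fin q => T)
      (α.toMultilinearMap.smulRight η.toMultilinearMap)).domDomCongr finSumFinEquiv)

theorem wedgeAlt_apply {p q : ℕ} (α : T [⋀^Fin p]→ₗ[ℝ] ℝ) (η : T [⋀^Fin q]→ₗ[ℝ] ℝ)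
    (X : Fin (p + q) → T) :
    wedgeAlt α η X = ((1 : ℝ) / (p.factorial * q.factorial)) *
      ∑ σ : Equiv.Perm (Fin (p + q)), ((Equiv.Perm.sign σ : ℤ) : ℝ) *
        ((α fun i => X (σ (Fin.castAdd q i))) * η fun j => X (σ (Fin.natAdd p j))) := by
  simp [wedgeAlt, MultilinearMap.alternatization_apply, Units.smul_def, zsmul_eq_mul]

theorem wedgeAlt_add_left {p q : ℕ} (α α' : T [⋀^Fin p]→ₗ[ℝ] ℝ) (β : T [⋀^Fin q]→ₗ[ℝ] ℝ) :
    wedgeAlt (α + α') β = wedgeAlt α β + wedgeAlt α' β := by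
  ext X
  simp only [wedgeAlt_apply, AlternatingMap.add_apply, ← mul_add, ← Finset.sum_add_distrib,
    add_mul]

theorem wedgeAlt_smul_left {p q : ℕ} (c : ℝ) (α : T [⋀^Fin p]→ₗ[ℝ] ℝ)
    (β : T [⋀^Fin q]→ₗ[ℝ] ℝ) : wedgeAlt (c • α) β = c • wedgeAlt α β := by
  ext X
  simp only [wedgeAlt_apply, AlternatingMap.smul_apply, smul_eq_mul, Finset.mul_sum]
  exact Finset.sum_congr rfl fun σ _ => by ring

theorem wedgeAlt_add_right {p q : ℕ} (α : T [⋀^Fin p]→ₗ[ℝ] ℝ) (β β' : T [⋀^Fin q]→ₗ[ℝ] ℝ) :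
    wedgeAlt α (β + β') = wedgeAlt α β + wedgeAlt α β' := by
  ext X
  simp only [wedgeAlt_apply, AlternatingMap.add_apply, ← mul_add, ← Finset.sum_add_distrib]

theorem wedgeAlt_smul_right {p q : ℕ} (c : ℝ) (α : T [⋀^Fin p]→ₗ[ℝ] ℝ)
    (β : T [⋀^Fin q]→ₗ[ℝ] ℝ) : wedgeAlt α (c • β) = c • wedgeAlt α β := by
  ext X
  simp only [wedgeAlt_apply, AlternatingMap.smul_apply, smul_eq_mul, Finset.mul_sum]
  exact Finset.sum_congr rfl fun σ _ => by ring

end Pointwise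

/-- The bilinear extension to direct sums of a family of bilinear maps on the summands. -/
def bilinExt {A B : ℕ → Type*} {C : Type*} [∀ i, AddCommGroup (A i)] [∀ i, Module ℝ (A i)]
    [∀ i, AddCommGroup (B i)] [∀ i, Module ℝ (B i)] [AddCommGroup C] [Module ℝ C]
    (f : ∀ m p, A m →ₗ[ℝ] B p →ₗ[ℝ] C) : (⨁ i, A i) →ₗ[ℝ] (⨁ i, B i) →ₗ[ℝ] C :=
  DirectSum.toModule ℝ ℕ _ fun m =>
    (DirectSum.toModule ℝ ℕ (A m →ₗ[ℝ] C) fun p => (f m p).flip).flip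

theorem bilinExt_lof {A B : ℕ → Type*} {C : Type*} [∀ i, AddCommGroup (A i)]
    [∀ i, Module ℝ (A i)] [∀ i, AddCommGroup (B i)] [∀ i, Module ℝ (B i)]
    [AddCommGroup C] [Module ℝ C] (f : ∀ m p, A m →ₗ[ℝ] B p →ₗ[ℝ] C) (m p : ℕ)
    (a : A m) (b : B p) :
    bilinExt f (DirectSum.lof ℝ ℕ A m a) (DirectSum.lof ℝ ℕ B p b) = f m p a b := by
  simp [bilinExt]

/-! ## Smooth differential forms -/

section Forms

variable (E : Type*) [NormedAddCommGroup E] [NormedSpace ℝ E]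
  (M : Type*) [TopologicalSpace M] [ChartedSpace E M] [IsManifold 𝓘(ℝ, E) ∞ M]

/-- Smooth vector fields on `M`. -/
abbrev VField := Cₛ^∞⟮𝓘(ℝ, E); E, (TangentSpace 𝓘(ℝ, E) : M → Type _)⟯

/-- `p`-forms on `M` with values in the vector bundle `V` (with typical fibre `F`): families of
alternating `p`-linear maps on the tangent spaces which yield a smooth section of `V` when
evaluated on smooth vector fields. -/
def bformSubmodule (F : Type*) [NormedAddCommGroup F] [NormedSpace ℝ F] (V : M → Type*)
    [TopologicalSpace (TotalSpace F V)] [∀ x, AddCommGroup (V x)] [∀ x, Module ℝ (V x)]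
    [∀ x, TopologicalSpace (V x)] [FiberBundle F V] [VectorBundle ℝ F V] (p : ℕ) :
    Submodule ℝ (∀ x : M, TangentSpace 𝓘(ℝ, E) x [⋀^Fin p]→ₗ[ℝ] V x) where
  carrier := {α | ∀ X : Fin p → VField E M,
    ContMDiff 𝓘(ℝ, E) (𝓘(ℝ, E).prod 𝓘(ℝ, F)) ∞
      fun x => TotalSpace.mk' F x (α x fun i => X i x)}
  add_mem' ha hb X := ContMDiff.add_section (ha X) (hb X)
  zero_mem' _ := Bundle.contMDiff_zeroSection ℝ V
  smul_mem' _ _ ha X := ContMDiff.const_smul_section (ha X)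

section
variable (F : Type*) [NormedAddCommGroup F] [NormedSpace ℝ F] (V : M → Type*)
  [TopologicalSpace (TotalSpace F V)] [∀ x, AddCommGroup (V x)] [∀ x, Module ℝ (V x)]
  [∀ x, TopologicalSpace (V x)] [FiberBundle F V] [VectorBundle ℝ F V] (p : ℕ)

/-- The real vector space `Ω^p(M; V)` of smooth `V`-valued `p`-forms. -/
def BForm : Type _ := bformSubmodule E M F V p

instance : AddCommGroup (BForm E M F V p) :=
  inferInstanceAs (AddCommGroup (bformSubmodule E M F V p))

instance : Module ℝ (BForm E M F V p) :=
  inferInstanceAs (Module ℝ (bformSubmodule E M F V p))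

end

/-- `Ω^p(M)`. -/
abbrev Form (p : ℕ) := BForm E M ℝ (Bundle.Trivial M ℝ) p

/-- `Ω^p(M; TM)`. -/
abbrev VForm (p : ℕ) := BForm E M E (TangentSpace 𝓘(ℝ, E) : M → Type _) p

/-- `Ω(M) = ⨁_p Ω^p(M)`. -/
abbrev Forms := ⨁ p, Form E M p

/-- `Ω(M; TM) = ⨁_p Ω^p(M; TM)`. -/
abbrev VForms := ⨁ p, VForm E M p

/-- The elements of `Ω(M)` of degree `q`; for negative `q` only `0`. -/
def formDeg (q : ℤ) : Submodule ℝ (Forms E M) where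
  carrier := {α | ∀ j : ℕ, (j : ℤ) ≠ q → α j = 0}
  add_mem' ha hb j hj := by
    rw [DirectSum.add_apply, ha j hj, hb j hj, add_zero]
  zero_mem' _ _ := rfl
  smul_mem' c a ha j hj := by
    rw [DirectSum.smul_apply, ha j hj, smul_zero]

/-- The elements of `Ω(M; TM)` of degree `q`; for negative `q` only `0`. -/
def vformDeg (q : ℤ) : Submodule ℝ (VForms E M) where
  carrier := {K | ∀ j : ℕ, (j : ℤ) ≠ q → K j = 0}
  add_mem' ha hb j hj := by
    rw [DirectSum.add_apply, ha j hj, hb j hj, add_zero]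
  zero_mem' _ _ := rfl
  smul_mem' c a ha j hj := by
    rw [DirectSum.smul_apply, ha j hj, smul_zero]

/-- A smooth vector bundle homomorphism `TM → TM` over the identity of `M`. -/
structure BundleEnd where
  toFun : ∀ x : M, TangentSpace 𝓘(ℝ, E) x →ₗ[ℝ] TangentSpace 𝓘(ℝ, E) x
  smooth' : ∀ X : VField E M, ContMDiff 𝓘(ℝ, E) (𝓘(ℝ, E).prod 𝓘(ℝ, E)) ∞
    fun x => TotalSpace.mk' E (E := (TangentSpace 𝓘(ℝ, E) : M → Type _)) x (toFun x (X x))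

/-- A connection for `F ⊆ TM`: a smooth fibrewise linear projection `φ : TM → F`. (The existence
of `φ` forces `F = im φ` to be a smooth sub vector bundle.) -/
structure Connection (F : ∀ x : M, Submodule ℝ (TangentSpace 𝓘(ℝ, E) x)) where
  φ : BundleEnd E M
  isProj : ∀ x, LinearMap.IsProj (F x) (φ.toFun x)

variable {E M}

/-- The action of a bundle endomorphism on vector fields. -/
def BundleEnd.onField (g : BundleEnd E M) (X : VField E M) : VField E M :=
  ⟨fun x => g.toFun x (X x), g.smooth' X⟩

/-- A vector valued form, evaluated on vector fields, is a vector field. -/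
def VForm.onFields {m : ℕ} (K : VForm E M m) (X : Fin m → VField E M) : VField E M :=
  ⟨fun x => K.1 x fun i => X i x, K.2 X⟩

variable (E M) in
/-- The identity of `TM`. -/
def BundleEnd.id : BundleEnd E M := ⟨fun _ => LinearMap.id, fun X => X.contMDiff⟩

/-- The horizontal projection `h = Id - φ`. -/
def Connection.h {F : ∀ x : M, Submodule ℝ (TangentSpace 𝓘(ℝ, E) x)} (c : Connection E M F) :
    BundleEnd E M :=
  ⟨fun x => LinearMap.id - c.φ.toFun x,
    fun X => ContMDiff.sub_section X.contMDiff (c.φ.smooth' X)⟩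

/-! ### Operators on forms -/

section Bundle

variable {F : Type*} [NormedAddCommGroup F] [NormedSpace ℝ F] {V : M → Type*}
  [TopologicalSpace (TotalSpace F V)] [∀ x, AddCommGroup (V x)] [∀ x, Module ℝ (V x)]
  [∀ x, TopologicalSpace (V x)] [FiberBundle F V] [VectorBundle ℝ F V]

/-- `α ↦ α ∘ Λ^p g` on `V`-valued `p`-forms. -/
def precompDeg (g : BundleEnd E M) (p : ℕ) : BForm E M F V p →ₗ[ℝ] BForm E M F V p where
  toFun α := ⟨fun x => (α.1 x).compLinearMap (g.toFun x),
    fun X => α.2 fun i => g.onField (X i)⟩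
  map_add' _ _ := rfl
  map_smul' _ _ := rfl

/-- Insertion of `K ∈ Ω^m(M; TM)` into `V`-valued `(q+1)`-forms, twisted by `g`. -/
def insDeg (g : BundleEnd E M) (m q : ℕ) :
    VForm E M m →ₗ[ℝ] BForm E M F V (q + 1) →ₗ[ℝ] BForm E M F V (m + q) :=
  LinearMap.mk₂ ℝ
    (fun K α => ⟨fun x => insAlt (g.toFun x) (K.1 x) (α.1 x), fun X => by
      simp only [insAlt_apply]
      refine ContMDiff.const_smul_section (ContMDiff.sum_section fun σ _ =>
        ContMDiff.const_smul_section ?_)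
      have h := α.2 (Fin.cons (VForm.onFields K fun i => X (σ (Fin.castAdd q i)))
        fun j => g.onField (X (σ (Fin.natAdd m j))))
      convert h using 4 with x
      funext i
      refine Fin.cases ?_ (fun j => ?_) i <;> rfl⟩)
    (fun K K' α => Subtype.ext (funext fun x => insAlt_add_left _ (K.1 x) (K'.1 x) (α.1 x)))
    (fun c K α => Subtype.ext (funext fun x => insAlt_smul_left _ c (K.1 x) (α.1 x)))
    (fun K α β => Subtype.ext (funext fun x => insAlt_add_right _ (K.1 x) (α.1 x) (β.1 x)))
    (fun c K α => Subtype.ext (funext fun x => insAlt_smul_right _ c (K.1 x) (α.1 x)))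

variable (F V) in
/-- `(K, α) ↦ i^g(K) α` for `K ∈ Ω(M; TM)` and `V`-valued forms `α`: it vanishes for `α` of degree
`0` and is given by the antisymmetrization formula of `insAlt` in positive degrees. For `g = h`
this is the explicit operator `i^h(K)`, for `g = Id` it is the usual insertion operator `i(K)`. -/
def insTot (g : BundleEnd E M) :
    VForms E M →ₗ[ℝ] (⨁ p, BForm E M F V p) →ₗ[ℝ] ⨁ p, BForm E M F V p :=
  bilinExt fun m p => match p with
    | 0 => 0
    | q + 1 => (insDeg g m q).compr₂ (DirectSum.lof ℝ ℕ (fun p => BForm E M F V p) (m + q))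

end Bundle

/-- `i^g(K) : Ω(M) → Ω(M)`. -/
abbrev ins (g : BundleEnd E M) : VForms E M →ₗ[ℝ] Forms E M →ₗ[ℝ] Forms E M :=
  insTot ℝ (Bundle.Trivial M ℝ) g

/-- `i^g(K) : Ω(M; TM) → Ω(M; TM)`. -/
abbrev vins (g : BundleEnd E M) : VForms E M →ₗ[ℝ] VForms E M →ₗ[ℝ] VForms E M :=
  insTot E (TangentSpace 𝓘(ℝ, E) : M → Type _) g

/-- `g^* : Ω(M) → Ω(M)`, `(g^* α)(X₁, …, X_p) = α (g X₁, …, g X_p)`. -/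
def pull (g : BundleEnd E M) : Forms E M →ₗ[ℝ] Forms E M := DirectSum.lmap (precompDeg g)

/-- `K ↦ K ∘ Λg`. -/
def precomp (g : BundleEnd E M) : VForms E M →ₗ[ℝ] VForms E M := DirectSum.lmap (precompDeg g)

/-- `K ↦ g ∘ K`. -/
def postcomp (g : BundleEnd E M) : VForms E M →ₗ[ℝ] VForms E M :=
  DirectSum.lmap fun _ =>
    { toFun := fun K => ⟨fun x => (g.toFun x).compAlternatingMap (K.1 x),
        fun X => g.smooth' (VForm.onFields K X)⟩
      map_add' := fun K K' => Subtype.ext (funext fun x => AlternatingMap.ext fun X =>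
        map_add (g.toFun x) _ _)
      map_smul' := fun c K => Subtype.ext (funext fun x => AlternatingMap.ext fun X =>
        map_smul (g.toFun x) _ _) }

/-- `K ↦ α ∘ K` for a `1`-form `α`. -/
def oneFormComp (α : Form E M 1) : VForms E M →ₗ[ℝ] Forms E M :=
  DirectSum.lmap fun _ =>
    { toFun := fun K => ⟨fun x => ((AlternatingMap.ofSubsingleton ℝ
          (TangentSpace 𝓘(ℝ, E) x) ℝ (0 : Fin 1)).symm (α.1 x)).compAlternatingMap (K.1 x),
        fun X => α.2 fun _ => VForm.onFields K X⟩
      map_add' := fun K K' => Subtype.ext (funext fun x => AlternatingMap.ext fun X =>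
        map_add ((AlternatingMap.ofSubsingleton ℝ
          (TangentSpace 𝓘(ℝ, E) x) ℝ (0 : Fin 1)).symm (α.1 x)) _ _)
      map_smul' := fun c K => Subtype.ext (funext fun x => AlternatingMap.ext fun X =>
        map_smul ((AlternatingMap.ofSubsingleton ℝ
          (TangentSpace 𝓘(ℝ, E) x) ℝ (0 : Fin 1)).symm (α.1 x)) _ _) }

/-- Sections of the trivial line bundle are smooth iff the corresponding functions are. -/
theorem contMDiff_trivial_iff (f : M → ℝ) :
    ContMDiff 𝓘(ℝ, E) (𝓘(ℝ, E).prod 𝓘(ℝ, ℝ)) ∞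
      (fun x => TotalSpace.mk' ℝ (E := Bundle.Trivial M ℝ) x (f x)) ↔
    ContMDiff 𝓘(ℝ, E) 𝓘(ℝ, ℝ) ∞ f := by
  refine forall_congr' fun x => ?_
  rw [contMDiffAt_section]
  rfl

/-- The wedge product of a `p`-form and a `q`-form. -/
def wedgeDeg (p q : ℕ) : Form E M p →ₗ[ℝ] Form E M q →ₗ[ℝ] Form E M (p + q) :=
  LinearMap.mk₂ ℝ
    (fun α β => ⟨fun x => wedgeAlt (T := TangentSpace 𝓘(ℝ, E) x) (α.1 x) (β.1 x), fun X => by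
      refine (contMDiff_trivial_iff _).2 ?_
      simp only [wedgeAlt_apply]
      refine contMDiff_const.mul (ContMDiff.sum fun σ _ => contMDiff_const.mul ?_)
      exact ((contMDiff_trivial_iff _).1 (α.2 fun i => X (σ (Fin.castAdd q i)))).mul
        ((contMDiff_trivial_iff _).1 (β.2 fun j => X (σ (Fin.natAdd p j))))⟩)
    (fun α α' β => Subtype.ext (funext fun x => wedgeAlt_add_left _ _ _))
    (fun c α β => Subtype.ext (funext fun x => wedgeAlt_smul_left _ _ _))
    (fun α β β' => Subtype.ext (funext fun x => wedgeAlt_add_right _ _ _))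
    (fun c α β => Subtype.ext (funext fun x => wedgeAlt_smul_right _ _ _))

variable (E M) in
/-- The wedge product on `Ω(M)`. -/
def wedge : Forms E M →ₗ[ℝ] Forms E M →ₗ[ℝ] Forms E M :=
  bilinExt fun p q => (wedgeDeg p q).compr₂ (DirectSum.lof ℝ ℕ (Form E M) (p + q))

/-! ### Derivations over `h^*` -/

/-- `D` is a graded derivation over `h^*` of degree `k` of the graded algebra `Ω(M)`. -/
structure IsDerivation (h : BundleEnd E M) (k : ℤ) (D : Forms E M →ₗ[ℝ] Forms E M) : Prop where
  degree : ∀ q : ℤ, ∀ α ∈ formDeg E M q, D α ∈ formDeg E M (q + k)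
  leibniz : ∀ q : ℤ, ∀ α ∈ formDeg E M q, ∀ β : Forms E M,
    D (wedge E M α β) =
      wedge E M (D α) (pull h β) + (-1 : ℝ) ^ (k * q) • wedge E M (pull h α) (D β)

/-- `D` is an algebraic derivation over `h^*` of degree `k`: it vanishes on `Ω⁰(M)`. -/
structure IsAlgebraicDerivation (h : BundleEnd E M) (k : ℤ)
    (D : Forms E M →ₗ[ℝ] Forms E M) : Prop extends IsDerivation h k D where
  algebraic : ∀ f ∈ formDeg E M 0, D f = 0

/-- The graded commutator `[D₁, D₂] = D₁ ∘ D₂ - (-1)^{kl} D₂ ∘ D₁` of endomorphisms of `Ω(M)` of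
degrees `k` and `l`. -/
def gradedComm (k l : ℤ) (D₁ D₂ : Forms E M →ₗ[ℝ] Forms E M) : Forms E M →ₗ[ℝ] Forms E M :=
  D₁ ∘ₗ D₂ - (-1 : ℝ) ^ (k * l) • D₂ ∘ₗ D₁

/-- `Der_k^h Ω(M)`: the derivations over `h^*` of degree `k` which commute with `h^*`. -/
def IsDerH (h : BundleEnd E M) (k : ℤ) (D : Forms E M →ₗ[ℝ] Forms E M) : Prop :=
  IsDerivation h k D ∧ D ∘ₗ pull h = pull h ∘ₗ D

/-! ### The bracket -/

/-- `Ω^q(M; TM)^h`: the `K ∈ Ω^q(M; TM)` with `h ∘ K = K ∘ Λ^q h`. -/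
def equivariant (h : BundleEnd E M) (q : ℤ) : Submodule ℝ (VForms E M) :=
  vformDeg E M q ⊓ LinearMap.eqLocus (postcomp h) (precomp h)

/-- `[K, L]^{∧,h} = i^h(K) L - (-1)^{kl} i^h(L) K` for `K ∈ Ω^{k+1}(M; TM)` and
`L ∈ Ω^{l+1}(M; TM)`, as a bilinear map. -/
def bracket (h : BundleEnd E M) (k l : ℤ) : VForms E M →ₗ[ℝ] VForms E M →ₗ[ℝ] VForms E M :=
  vins h - (-1 : ℝ) ^ (k * l) • (vins h).flip

end Forms

/-- The bilinear maps `br k l` (on elements of degrees `k` and `l`) make the `ℤ`-graded vector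
space `⨁_k 𝔤 k`, with `𝔤 k` subspaces of `A`, a graded Lie algebra. -/
structure IsGradedLieAlgebra {A : Type*} [AddCommGroup A] [Module ℝ A]
    (𝔤 : ℤ → Submodule ℝ A) (br : ℤ → ℤ → A →ₗ[ℝ] A →ₗ[ℝ] A) : Prop where
  mem : ∀ k l : ℤ, ∀ a ∈ 𝔤 k, ∀ b ∈ 𝔤 l, br k l a b ∈ 𝔤 (k + l)
  skew : ∀ k l : ℤ, ∀ a ∈ 𝔤 k, ∀ b ∈ 𝔤 l, br k l a b = -((-1 : ℝ) ^ (k * l) • br l k b a)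
  jacobi : ∀ k l n : ℤ, ∀ a ∈ 𝔤 k, ∀ b ∈ 𝔤 l, ∀ c ∈ 𝔤 n,
    br k (l + n) a (br l n b c) =
      br (k + l) n (br k l a b) c + (-1 : ℝ) ^ (k * l) • br l (k + n) b (br k n a c)

end

end HDer

/-!
Everything rests on three facts about the operators `i^h(K)`.

*They are algebraic derivations over `h^*`.* On one tangent space this is a statement about
antisymmetrizations. The interior product with a vector is an antiderivation of the wedge product
(`wedgeAlt_cons`, by sorting the permutations according to the place that receives the vector).
Inserting `K` antisymmetrizes the interior product with the values of `K`, nested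
antisymmetrizations collapse up to a factorial (`altSum_absorb`), and moving the arguments of `K`
past those of `α` gives the sign (`altSum_flip3`). This yields `insAlt_wedgeAlt`.

*An algebraic derivation is determined by its values on `1`-forms, and these are given by a unique
`K`.* An algebraic derivation is linear over smooth functions. Bump functions in charts provide
global vector fields `eᵢ` and `1`-forms `θᵢ` with `∑ θᵢ ⊗ eᵢ = φ • Id`, where `φ = 1` near a given
point (`exists_bump_frame`). Applying the derivation to the identity `p φ α = ∑ θᵢ ∧ i(eᵢ) α` for
`p`-forms `α` reduces its values on `p`-forms to those on `1`-forms and on `(p-1)`-forms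
(`IsAlgebraicDerivation.ext`); on `1`-forms it is composition with `K = ∑ D θᵢ ⊗ eᵢ`
(`exists_vform_of_tensorial`). In particular `K ↦ i^h(K)` is injective (`ins_injective`).

*The relations between `i(K)`, `i^h(K)` and `h^*`* are immediate from the explicit formula and
`h ∘ h = h`. With injectivity they show that `i^h(K)` commutes with `h^*` exactly if
`h ∘ K = K ∘ Λh`.

The graded commutator of two derivations over `h^*` which commute with `h^*` is again one, since
`h^* ∘ h^* = h^*`. Comparing values on `1`-forms gives `i^h([K, L]) = [i^h(K), i^h(L)]`
(`ins_bracket`), and the graded Lie algebra axioms are inherited from the graded commutator along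
the injective map `i^h`.
-/

namespace HDer

noncomputable section

/-! ### Smooth partial frames -/

section Frames

variable {E : Type*} [NormedAddCommGroup E] [NormedSpace ℝ E]
  {M : Type*} [TopologicalSpace M] [ChartedSpace E M] [IsManifold 𝓘(ℝ, E) ∞ M]

/-- The `1`-form attached to a family of covectors which is smooth along vector fields. -/
def oneForm (ξ : ∀ x : M, TangentSpace 𝓘(ℝ, E) x →ₗ[ℝ] ℝ)
    (hξ : ∀ X : VField E M, ContMDiff 𝓘(ℝ, E) 𝓘(ℝ, ℝ) ∞ fun x => ξ x (X x)) : Form E M 1 :=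
  ⟨fun x => AlternatingMap.ofSubsingleton ℝ (TangentSpace 𝓘(ℝ, E) x) ℝ (0 : Fin 1) (ξ x),
    fun X => (contMDiff_trivial_iff _).2 (hξ (X 0))⟩

/-- Global vector fields `eᵢ` and `1`-forms `θᵢ` with `∑ θᵢ ⊗ eᵢ = φ • Id`, where `φ = 1` near `x₀`.
Here `φ = f ^ 2` for a bump function `f` in a chart around `x₀`: one factor cuts off the coordinate
vector fields and the other one the coordinate `1`-forms. -/
theorem exists_bump_frame [FiniteDimensional ℝ E] [T2Space M] (x₀ : M) :
    ∃ (φ : C^∞⟮𝓘(ℝ, E), M; ℝ⟯) (e : Fin (Module.finrank ℝ E) → VField E M)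
      (θ : Fin (Module.finrank ℝ E) → Form E M 1),
      φ =ᶠ[nhds x₀] 1 ∧
      ∀ x (v : TangentSpace 𝓘(ℝ, E) x), ∑ i, (θ i).1 x (fun _ => v) • e i x = φ x • v := by
  classical
  let b := Module.finBasis ℝ E
  let t := trivializationAt E (TangentSpace 𝓘(ℝ, E) : M → Type _) x₀
  let f : SmoothBumpFunction 𝓘(ℝ, E) x₀ := Classical.arbitrary _
  have hts : tsupport f ⊆ t.baseSet := by
    simpa [t] using f.tsupport_subset_chartAt_source
  have hsm : ∀ i, ContMDiff 𝓘(ℝ, E) (𝓘(ℝ, E).prod 𝓘(ℝ, E)) ∞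
      fun x => TotalSpace.mk' E (E := (TangentSpace 𝓘(ℝ, E) : M → Type _)) x
        (f x • t.localFrame b i x) := fun i =>
    ContMDiffOn.smul_section_of_tsupport f.contMDiff.contMDiffOn t.open_baseSet hts
      (t.contMDiffOn_localFrame_baseSet ∞ b i)
  have hco : ∀ i, ∀ X : VField E M, ContMDiff 𝓘(ℝ, E) 𝓘(ℝ, ℝ) ∞
      fun x => (f x • t.localFrameCoeff 𝓘(ℝ, E) b i x) (X x) := fun i X => by
    refine f.contMDiff_smul ?_
    have := contMDiffOn_localFrameCoeff (I := 𝓘(ℝ, E)) (e := t) (k := ∞) b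
      (s := fun x => X x) t.open_baseSet subset_rfl X.contMDiff.contMDiffOn i
    simpa [t] using this
  refine ⟨⟨fun x => f x * f x, f.contMDiff.mul f.contMDiff⟩, fun i => ⟨_, hsm i⟩,
    fun i => oneForm _ (hco i), ?_, fun x v => ?_⟩
  · filter_upwards [f.eventuallyEq_one] with x hx
    change f x * f x = 1
    simp [hx]
  · by_cases hx : x ∈ t.baseSet
    -- The expansion in a local frame is stated for sections; extend `v` to a section.
    · have h := t.eq_sum_localFrameCoeff_smul (I := 𝓘(ℝ, E)) (b := b) hx
        (s := Function.update (fun y => (0 : TangentSpace 𝓘(ℝ, E) y)) x v)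
      rw [Function.update_self] at h
      conv_rhs => rw [h]
      rw [Finset.smul_sum]
      refine Finset.sum_congr rfl fun i _ => ?_
      change (f x * t.localFrameCoeff 𝓘(ℝ, E) b i x v) • (f x • t.localFrame b i x) =
        (f x * f x) • (t.localFrameCoeff 𝓘(ℝ, E) b i x v • t.localFrame b i x)
      simp only [smul_smul]
      ring_nf
    · have h0 : f x = 0 := image_eq_zero_of_notMem_tsupport fun h => hx (hts h)
      refine (Finset.sum_eq_zero fun i _ => ?_).trans
        (show 0 = (f x * f x) • v by rw [h0, mul_zero, zero_smul])
      change _ • (f x • t.localFrame b i x) = 0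
      rw [h0, zero_smul, smul_zero]

end Frames

/-! ### Antisymmetrization -/

section AltSum

open Equiv

variable {N N' A T W : Type*} [Fintype N] [DecidableEq N] [Fintype N'] [DecidableEq N']
  [Fintype A] [DecidableEq A] [AddCommGroup W] [Module ℝ W]

/-- The unnormalized antisymmetrization `X ↦ ∑_σ ε(σ) f (X ∘ σ)` of a function of finitely many
arguments, which may be indexed by any finite type. -/
def altSum (f : (N → T) → W) (X : N → T) : W :=
  ∑ σ : Perm N, ((Perm.sign σ : ℤ) : ℝ) • f fun i => X (σ i)

theorem altSum_comp (f : (N → T) → W) (X : N → T) (τ : Perm N) :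
    altSum (fun Z => f fun i => Z (τ i)) X = ((Perm.sign τ : ℤ) : ℝ) • altSum f X := by
  rw [altSum, altSum, ← Equiv.sum_comp (Equiv.mulRight τ⁻¹), Finset.smul_sum]
  refine Finset.sum_congr rfl fun σ _ => ?_
  have h : ∀ i, (σ * τ⁻¹) (τ i) = σ i := fun i => by simp
  simp only [Equiv.coe_mulRight, Perm.sign_mul, Perm.sign_inv, smul_smul, h]
  push_cast
  rw [mul_comm]

theorem altSum_reindex (e : N' ≃ N) (f : (N' → T) → W) (X : N → T) :
    altSum (fun Z => f fun i => Z (e i)) X = altSum f fun i => X (e i) := by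
  rw [altSum, altSum, ← Equiv.sum_comp e.permCongr]
  refine Finset.sum_congr rfl fun σ _ => ?_
  simp [Perm.sign_permCongr]

/-- Antisymmetrizing over some of the arguments first only contributes a factorial. -/
theorem altSum_absorb (ρ : Perm A → Perm N) (hρ : ∀ τ, Perm.sign (ρ τ) = Perm.sign τ)
    (f : (N → T) → W) (X : N → T) :
    altSum (fun Z => ∑ τ : Perm A, ((Perm.sign τ : ℤ) : ℝ) • f fun i => Z (ρ τ i)) X =
      ((Fintype.card A).factorial : ℝ) • altSum f X := by
  simp_rw [altSum, Finset.smul_sum (N := W) (s := (Finset.univ : Finset (Perm A)))]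
  rw [Finset.sum_comm]
  have h : ∀ τ : Perm A, ∑ σ : Perm N, ((Perm.sign σ : ℤ) : ℝ) • ((Perm.sign τ : ℤ) : ℝ) •
      f (fun i => X (σ (ρ τ i))) = altSum f X := by
    intro τ
    simp_rw [smul_smul, mul_comm _ ((Perm.sign τ : ℤ) : ℝ), ← smul_smul, ← Finset.smul_sum]
    have h := altSum_comp f X (ρ τ)
    simp only [altSum] at h ⊢
    rw [h, hρ, smul_smul, ← Int.cast_mul, Int.units_coe_mul_self, Int.cast_one, one_smul]
  simp_rw [h]
  rw [Finset.sum_const, Finset.card_univ, Fintype.card_perm, Nat.cast_smul_eq_nsmul]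
  rfl

theorem altSum_add (f f' : (N → T) → W) (X : N → T) :
    altSum (fun Z => f Z + f' Z) X = altSum f X + altSum f' X := by
  simp only [altSum, smul_add, Finset.sum_add_distrib]

theorem altSum_smul (c : ℝ) (f : (N → T) → W) (X : N → T) :
    altSum (fun Z => c • f Z) X = c • altSum f X := by
  simp only [altSum, Finset.smul_sum, smul_comm c]

/-- Expansion of an antisymmetrization by the place `j = τ⁻¹ 0` that receives the first
argument. -/
theorem altSum_cons {n : ℕ} (f : (Fin (n + 1) → T) → W) (y : T) (Y : Fin n → T) :
    altSum f (Fin.cons y Y : Fin (n + 1) → T) =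
      ∑ j : Fin (n + 1), (-1 : ℝ) ^ (j : ℕ) • altSum (fun Z => f (j.insertNth y Z)) Y := by
  simp_rw [altSum, Finset.smul_sum]
  rw [← Fintype.sum_prod_type'
    (fun (j : Fin (n + 1)) (e : Perm (Fin n)) => (-1 : ℝ) ^ (j : ℕ) • ((Perm.sign e : ℤ) : ℝ) •
        f (j.insertNth y fun i => Y (e i)))]
  symm
  -- `Φ (j, e)` sends `j` to `0` and the remaining places to `1, …, n` according to `e`.
  let Φ : Fin (n + 1) × Perm (Fin n) → Perm (Fin (n + 1)) := fun je =>
    Perm.decomposeFin.symm (0, je.2) * je.1.cycleRange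
  have hΦ : ∀ j e i, Φ (j, e) (j.succAbove i) = (e i).succ := fun j e i => by
    simp [Φ]
  have hΦ0 : ∀ j e, Φ (j, e) j = 0 := fun j e => by simp [Φ]
  refine Fintype.sum_bijective Φ ((Fintype.bijective_iff_injective_and_card _).2 ⟨?_, ?_⟩) _ _ ?_
  · rintro ⟨j, e⟩ ⟨j', e'⟩ h
    have hj : j = j' := by
      apply (Φ (j', e')).injective
      rw [hΦ0, ← h, hΦ0]
    subst hj
    have : Perm.decomposeFin.symm (0, e) = Perm.decomposeFin.symm (0, e') := mul_right_cancel h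
    simpa using this
  · simp [Fintype.card_perm, Nat.factorial_succ]
  · rintro ⟨j, e⟩
    have hs : Perm.sign (Φ (j, e)) = (-1) ^ (j : ℕ) * Perm.sign e := by
      simp [Φ, Perm.decomposeFin.symm_sign, mul_comm]
    have hf : (fun i => (Fin.cons y Y : Fin (n + 1) → T) (Φ (j, e) i)) =
        j.insertNth y fun i => Y (e i) := by
      funext i
      refine Fin.succAboveCases j ?_ (fun i => ?_) i
      · simp [hΦ0]
      · simp [hΦ]
    rw [hf, hs, smul_smul]
    push_cast
    rfl

theorem finRotate_pow_val (N n : ℕ) (i : Fin N) : ((finRotate N ^ n) i : ℕ) = (i + n) % N := by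
  cases N with
  | zero => exact i.elim0
  | succ N =>
    induction n with
    | zero => simpa using (Nat.mod_eq_of_lt i.2).symm
    | succ n ih =>
      rw [pow_succ', Perm.mul_apply, finRotate_apply, Fin.val_add, ih]
      simp [← add_assoc]

/-- The permutation exchanging two consecutive blocks is a power of the cyclic permutation. -/
theorem sign_blockSwap (m n : ℕ) :
    Perm.sign ((finAddFlip (m := m) (n := n)).trans (finCongr (add_comm n m))) =
      (-1) ^ (m * n) := by
  have h : (finAddFlip (m := m) (n := n)).trans (finCongr (add_comm n m)) =
      finRotate (m + n) ^ n := by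
    ext i
    rw [finRotate_pow_val]
    refine Fin.addCases (fun i => ?_) (fun i => ?_) i
    · have := i.2
      simp [Nat.mod_eq_of_lt (show n + (i : ℕ) < m + n by omega), add_comm]
    · have := i.2
      simp [show m + (i : ℕ) + n = i + (m + n) by omega,
        Nat.mod_eq_of_lt (show (i : ℕ) < m + n by omega)]
  rw [h, map_pow, sign_finRotate, ← pow_mul]
  rcases Nat.eq_zero_or_pos n with rfl | hn
  · simp
  · have h2 : (m + n - 1) * n = m * n + (n - 1) * n := by
      rw [Nat.add_sub_assoc hn, add_mul]
    have h3 : Even ((n - 1) * n) := by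
      have := Nat.even_mul_succ_self (n - 1)
      rwa [Nat.sub_add_cancel hn] at this
    rw [h2, pow_add, h3.neg_one_pow, mul_one]

/-- Three consecutive blocks in their natural order. -/
def fin3 (a b c : ℕ) : Fin a ⊕ (Fin b ⊕ Fin c) ≃ Fin (a + (b + c)) :=
  (Equiv.sumCongr (Equiv.refl _) finSumFinEquiv).trans finSumFinEquiv

@[simp] theorem fin3_inl (a b c : ℕ) (i : Fin a) :
    fin3 a b c (Sum.inl i) = Fin.castAdd (b + c) i := rfl

@[simp] theorem fin3_inr_inl (a b c : ℕ) (i : Fin b) :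
    fin3 a b c (Sum.inr (Sum.inl i)) = Fin.natAdd a (Fin.castAdd c i) := rfl

@[simp] theorem fin3_inr_inr (a b c : ℕ) (i : Fin c) :
    fin3 a b c (Sum.inr (Sum.inr i)) = Fin.natAdd a (Fin.natAdd b i) := rfl

/-- Exchange of the first two of three blocks. -/
def flip3 (a b c : ℕ) : Fin a ⊕ (Fin b ⊕ Fin c) ≃ Fin b ⊕ (Fin a ⊕ Fin c) :=
  (Equiv.sumAssoc _ _ _).symm.trans
    ((Equiv.sumCongr (Equiv.sumComm _ _) (Equiv.refl _)).trans (Equiv.sumAssoc _ _ _))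

/-- Reordering the first two of three blocks of arguments contributes the sign `(-1) ^ (a * b)`. -/
theorem altSum_flip3 {a b c : ℕ} (f : (Fin a ⊕ (Fin b ⊕ Fin c) → T) → W)
    (X : Fin (a + (b + c)) → T) (h : b + (a + c) = a + (b + c)) :
    altSum f (fun i => X (Fin.cast h (fin3 b a c (flip3 a b c i)))) =
      (-1 : ℝ) ^ (a * b) • altSum f fun i => X (fin3 a b c i) := by
  let s : Perm (Fin (a + b)) := (finAddFlip (m := a) (n := b)).trans (finCongr (add_comm b a))
  let e : Fin a ⊕ (Fin b ⊕ Fin c) ≃ Fin (a + b) ⊕ Fin c :=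
    (Equiv.sumAssoc _ _ _).symm.trans (Equiv.sumCongr finSumFinEquiv (Equiv.refl _))
  let ψ : Perm (Fin a ⊕ (Fin b ⊕ Fin c)) := e.symm.permCongr (Perm.sumCongr s 1)
  have hψ : Perm.sign ψ = (-1) ^ (a * b) := by
    simp only [ψ, Perm.sign_permCongr, Perm.sign_sumCongr, Perm.sign_one, mul_one, s,
      sign_blockSwap]
  have key : ∀ i, Fin.cast h (fin3 b a c (flip3 a b c i)) = fin3 a b c (ψ i) := by
    intro i
    have h3 : ∀ i, fin3 a b c i = Fin.cast (add_assoc a b c) (finSumFinEquiv (e i)) := by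
      rintro (i | i | i) <;> ext <;> simp [e, add_assoc]
    rw [h3]
    simp only [ψ, Equiv.permCongr_apply, Equiv.symm_symm, Equiv.apply_symm_apply]
    rcases i with i | i | i <;> ext <;> simp [e, s, flip3, add_comm]
    omega
  simp_rw [key]
  have h1 := altSum_comp (fun Z => f Z) (fun i => X (fin3 a b c i)) ψ
  rw [hψ] at h1
  push_cast at h1
  rw [← h1]
  exact (altSum_reindex ψ f fun i => X (fin3 a b c i)).symm

theorem altSum_mul (f : (N → T) → ℝ) (b : ℝ)
    (X : N → T) : altSum (fun Z => f Z * b) X = altSum f X * b := by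
  simp only [altSum, Finset.sum_mul, smul_eq_mul, mul_assoc]

theorem mul_altSum (f : (N → T) → ℝ) (b : ℝ)
    (X : N → T) : altSum (fun Z => b * f Z) X = b * altSum f X :=
  altSum_smul b f X

/-- `altSum_absorb` for the last `n` of `m + n` arguments. The map `g` applied to these arguments
plays no role for the antisymmetrization. -/
theorem altSum_altSum_natAdd {T' : Type*} {m n : ℕ} (G : (Fin m → T) → (Fin n → T') → W)
    (g : T → T') (X : Fin (m + n) → T) :
    altSum (fun Z => altSum (G fun i => Z (Fin.castAdd n i)) fun j => g (Z (Fin.natAdd m j))) X =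
      (n.factorial : ℝ) • altSum (fun Z => G (fun i => Z (Fin.castAdd n i))
        fun j => g (Z (Fin.natAdd m j))) X := by
  have h := altSum_absorb (A := Fin n) (N := Fin (m + n))
    (fun τ => finSumFinEquiv.permCongr (Perm.sumCongr 1 τ)) (fun τ => by simp)
    (fun Z => G (fun i => Z (Fin.castAdd n i)) fun j => g (Z (Fin.natAdd m j))) X
  simpa [altSum] using h

/-- `altSum_absorb` for the first `m` of `m + n` arguments. -/
theorem altSum_altSum_castAdd {m n : ℕ} (G : (Fin m → T) → (Fin n → T) → W)
    (X : Fin (m + n) → T) :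
    altSum (fun Z => altSum (fun Z' => G Z' fun j => Z (Fin.natAdd m j))
        fun i => Z (Fin.castAdd n i)) X =
      (m.factorial : ℝ) • altSum (fun Z => G (fun i => Z (Fin.castAdd n i))
        fun j => Z (Fin.natAdd m j)) X := by
  have h := altSum_absorb (A := Fin m) (N := Fin (m + n))
    (fun τ => finSumFinEquiv.permCongr (Perm.sumCongr τ 1)) (fun τ => by simp)
    (fun Z => G (fun i => Z (Fin.castAdd n i)) fun j => Z (Fin.natAdd m j)) X
  simpa [altSum] using h

end AltSum

/-! ### The Leibniz rule on one vector space -/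

section PointwiseLeibniz

open Equiv

variable {T W : Type*} [AddCommGroup T] [Module ℝ T] [AddCommGroup W] [Module ℝ W]

theorem wedgeAlt_eq_altSum {p q : ℕ} (α : T [⋀^Fin p]→ₗ[ℝ] ℝ) (η : T [⋀^Fin q]→ₗ[ℝ] ℝ)
    (X : Fin (p + q) → T) :
    wedgeAlt α η X = ((1 : ℝ) / (p.factorial * q.factorial)) * altSum (fun Z =>
      (α fun i => Z (Fin.castAdd q i)) * η fun j => Z (Fin.natAdd p j)) X :=
  wedgeAlt_apply α η X

theorem insAlt_eq_altSum (g : T →ₗ[ℝ] T) {m q : ℕ} (K : T [⋀^Fin m]→ₗ[ℝ] T)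
    (α : T [⋀^Fin (q + 1)]→ₗ[ℝ] W) (X : Fin (m + q) → T) :
    insAlt g K α X = ((1 : ℝ) / (m.factorial * q.factorial)) • altSum (fun Z =>
      α (Fin.cons (K fun i => Z (Fin.castAdd q i)) fun j => g (Z (Fin.natAdd m j)))) X :=
  insAlt_apply g K α X

/-- The interior product with `y` is an antiderivation of the wedge product. -/
theorem wedgeAlt_cons {p q : ℕ} (α : T [⋀^Fin (p + 1)]→ₗ[ℝ] ℝ) (β : T [⋀^Fin (q + 1)]→ₗ[ℝ] ℝ)
    (y : T) (Y : Fin (p + 1 + q) → T) (h : p + (q + 1) = p + 1 + q) :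
    wedgeAlt α β (Fin.cons y Y : Fin (p + 1 + q + 1) → T) =
      ((1 : ℝ) / (p.factorial * (q + 1).factorial)) * altSum (fun Z =>
        α (Fin.cons y fun i => Z (Fin.cast h (Fin.castAdd (q + 1) i))) *
          β fun i => Z (Fin.cast h (Fin.natAdd p i))) Y +
      (-1) ^ (p + 1) * (((1 : ℝ) / ((p + 1).factorial * q.factorial)) * altSum (fun Z =>
        (α fun i => Z (Fin.castAdd q i)) * β (Fin.cons y fun i => Z (Fin.natAdd (p + 1) i))) Y)
      := by
  have hc : ∀ {n : ℕ} (γ : T [⋀^Fin (n + 1)]→ₗ[ℝ] ℝ) (j : Fin (n + 1)) (v : Fin n → T),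
      γ (j.insertNth y v) = (-1) ^ (j : ℕ) * γ (Fin.cons y v) := fun γ j v => by
    rw [γ.map_insertNth, zsmul_eq_mul]
    push_cast
    rfl
  have hs : ∀ n : ℕ, ((-1 : ℝ) ^ n) * (-1) ^ n = 1 := fun n => by
    rw [← mul_pow]; simp
  -- The vector `y` at the place `j` of the first block, and below of the second block: moving it to
  -- the front of the block costs `(-1) ^ j`.
  have hA : ∀ (j : Fin (p + 1)) (Z : Fin (p + 1 + q) → T),
      (α fun i => (Fin.insertNth (α := fun _ => T) (n := p + 1 + q) (Fin.castAdd (q + 1) j) y Z :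
          Fin (p + 1 + q + 1) → T) (Fin.castAdd (q + 1) i)) *
        (β fun i => (Fin.insertNth (α := fun _ => T) (n := p + 1 + q) (Fin.castAdd (q + 1) j) y Z :
          Fin (p + 1 + q + 1) → T) (Fin.natAdd (p + 1) i)) =
      (-1) ^ (j : ℕ) * (α (Fin.cons y fun i => Z (Fin.cast h (Fin.castAdd (q + 1) i))) *
          β fun i => Z (Fin.cast h (Fin.natAdd p i))) := by
    intro j Z
    rw [← mul_assoc, ← hc]
    congr 2
    · funext i
      refine Fin.succAboveCases j ?_ (fun i => ?_) i
      · rw [Fin.insertNth_apply_same, Fin.insertNth_apply_same]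
      · rw [Fin.insertNth_apply_succAbove]
        have : (Fin.castAdd (q + 1) (j.succAbove i) : Fin (p + 1 + q + 1)) =
            Fin.succAbove (n := p + 1 + q) (Fin.castAdd (q + 1) j)
              (Fin.cast h (Fin.castAdd (q + 1) i)) := by
          ext
          simp only [Fin.succAbove, Fin.lt_def]
          split_ifs <;> simp_all; omega
        rw [this, Fin.insertNth_apply_succAbove]
    · funext i
      have : (Fin.natAdd (p + 1) i : Fin (p + 1 + q + 1)) =
          Fin.succAbove (n := p + 1 + q) (Fin.castAdd (q + 1) j)
            (Fin.cast h (Fin.natAdd p i)) := by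
        have := j.2
        ext
        simp only [Fin.succAbove, Fin.lt_def]
        split_ifs with h1
        · simp at h1
          omega
        · simp
          omega
      rw [this, Fin.insertNth_apply_succAbove]
  have hB : ∀ (j : Fin (q + 1)) (Z : Fin (p + 1 + q) → T),
      (α fun i => (Fin.insertNth (α := fun _ => T) (n := p + 1 + q) (Fin.natAdd (p + 1) j) y Z :
          Fin (p + 1 + q + 1) → T) (Fin.castAdd (q + 1) i)) *
        (β fun i => (Fin.insertNth (α := fun _ => T) (n := p + 1 + q) (Fin.natAdd (p + 1) j) y Z :
          Fin (p + 1 + q + 1) → T) (Fin.natAdd (p + 1) i)) =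
      (-1) ^ (j : ℕ) * ((α fun i => Z (Fin.castAdd q i)) *
        β (Fin.cons y fun i => Z (Fin.natAdd (p + 1) i))) := by
    intro j Z
    rw [mul_left_comm, ← hc]
    congr 2
    · funext i
      have : (Fin.castAdd (q + 1) i : Fin (p + 1 + q + 1)) =
          Fin.succAbove (n := p + 1 + q) (Fin.natAdd (p + 1) j) (Fin.castAdd q i) := by
        have := i.2
        ext
        simp only [Fin.succAbove, Fin.lt_def]
        split_ifs with h1
        · simp
        · simp at h1
          omega
      rw [this, Fin.insertNth_apply_succAbove]
    · funext i
      refine Fin.succAboveCases j ?_ (fun i => ?_) i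
      · rw [Fin.insertNth_apply_same, Fin.insertNth_apply_same]
      · rw [Fin.insertNth_apply_succAbove]
        have : (Fin.natAdd (p + 1) (j.succAbove i) : Fin (p + 1 + q + 1)) =
            Fin.succAbove (n := p + 1 + q) (Fin.natAdd (p + 1) j) (Fin.natAdd (p + 1) i) := by
          ext
          simp only [Fin.succAbove, Fin.lt_def]
          split_ifs <;> simp_all <;> omega
        rw [this, Fin.insertNth_apply_succAbove]
  -- The sign `(-1) ^ j` cancels the one of `altSum_cons`, so all places of one block contribute
  -- equally; for the second block `(-1) ^ (p + 1)` remains.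
  have hsum : altSum (fun Z : Fin (p + 1 + (q + 1)) → T =>
      (α fun i => Z (Fin.castAdd (q + 1) i)) * β fun j => Z (Fin.natAdd (p + 1) j))
        (Fin.cons y Y : Fin (p + 1 + q + 1) → T) =
      ((p + 1 : ℕ) : ℝ) * altSum (fun Z =>
        α (Fin.cons y fun i => Z (Fin.cast h (Fin.castAdd (q + 1) i))) *
          β fun i => Z (Fin.cast h (Fin.natAdd p i))) Y +
      ((q + 1 : ℕ) : ℝ) * ((-1) ^ (p + 1) * altSum (fun Z =>
        (α fun i => Z (Fin.castAdd q i)) *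
          β (Fin.cons y fun i => Z (Fin.natAdd (p + 1) i))) Y) := by
    refine (altSum_cons (n := p + 1 + q) (fun Z => (α fun i => Z (Fin.castAdd (q + 1) i)) *
      β fun j => Z (Fin.natAdd (p + 1) j)) y Y).trans ?_
    refine (Fin.sum_univ_add (a := p + 1) (b := q + 1) _).trans ?_
    congr 1
    · simp_rw [hA, ← smul_eq_mul, altSum_smul, smul_smul, Fin.val_castAdd, hs, one_smul]
      simp
    · simp_rw [hB, ← smul_eq_mul, altSum_smul, smul_smul, Fin.val_natAdd, pow_add, mul_assoc, hs]
      simp [mul_assoc]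
  rw [wedgeAlt_eq_altSum]
  refine (congrArg _ hsum).trans ?_
  have h1 : ((p + 1).factorial : ℝ) = (p + 1 : ℕ) * p.factorial := by
    rw [Nat.factorial_succ]; push_cast; ring
  have h2 : ((q + 1).factorial : ℝ) = (q + 1 : ℕ) * q.factorial := by
    rw [Nat.factorial_succ]; push_cast; ring
  have h3 : (p.factorial : ℝ) ≠ 0 := by positivity
  have h4 : (q.factorial : ℝ) ≠ 0 := by positivity
  have h5 : ((p + 1 : ℕ) : ℝ) ≠ 0 := by positivity
  have h6 : ((q + 1 : ℕ) : ℝ) ≠ 0 := by positivity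
  rw [h1, h2]
  field_simp

/-- The Leibniz rule for `i^g(K)` over `g^*` in positive degrees. All three terms are expressed by
antisymmetrizations of one of two functions, whose arguments are indexed by three blocks: those of
`K`, those of `α`, and those of `β`. The casts identify the degrees, which agree only
propositionally. -/
theorem insAlt_wedgeAlt (g : T →ₗ[ℝ] T) {m p q : ℕ} (K : T [⋀^Fin m]→ₗ[ℝ] T)
    (α : T [⋀^Fin (p + 1)]→ₗ[ℝ] ℝ) (β : T [⋀^Fin (q + 1)]→ₗ[ℝ] ℝ)
    (X : Fin (m + (p + 1 + q)) → T) (h₁ : m + p + (q + 1) = m + (p + 1 + q))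
    (h₂ : p + 1 + (m + q) = m + (p + 1 + q)) :
    insAlt g K (q := p + 1 + q) (wedgeAlt (p := p + 1) (q := q + 1) α β) X =
      wedgeAlt (insAlt g K α) (β.compLinearMap g) (fun i => X (Fin.cast h₁ i)) +
      (-1) ^ ((m + 1) * (p + 1)) *
        wedgeAlt (α.compLinearMap g) (insAlt g K β) (fun i => X (Fin.cast h₂ i)) := by
  have h : p + (q + 1) = p + 1 + q := by omega
  let FA : (Fin m ⊕ (Fin p ⊕ Fin (q + 1)) → T) → ℝ := fun Z =>
    α (Fin.cons (K fun i => Z (Sum.inl i)) fun i => g (Z (Sum.inr (Sum.inl i)))) *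
      β fun i => g (Z (Sum.inr (Sum.inr i)))
  let FB : (Fin m ⊕ (Fin (p + 1) ⊕ Fin q) → T) → ℝ := fun Z =>
    (α fun i => g (Z (Sum.inr (Sum.inl i)))) *
      β (Fin.cons (K fun i => Z (Sum.inl i)) fun i => g (Z (Sum.inr (Sum.inr i))))
  let SA := altSum FA fun i => X (Fin.cast (by omega) (fin3 m p (q + 1) i))
  let SB := altSum FB fun i => X (fin3 m (p + 1) q i)
  have hL : insAlt g K (q := p + 1 + q) (wedgeAlt (p := p + 1) (q := q + 1) α β) X =
      (1 : ℝ) / (m.factorial * (p.factorial * (q + 1).factorial)) * SA +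
      (-1) ^ (p + 1) * ((1 : ℝ) / (m.factorial * ((p + 1).factorial * q.factorial)) * SB) := by
    have h3 : ((p + 1 + q).factorial : ℝ) ≠ 0 := by positivity
    have hA := altSum_altSum_natAdd (fun (V : Fin m → T) (Y : Fin (p + 1 + q) → T) =>
      α (Fin.cons (K V) fun i => Y (Fin.cast h (Fin.castAdd (q + 1) i))) *
          β fun i => Y (Fin.cast h (Fin.natAdd p i))) g X
    have hB := altSum_altSum_natAdd (fun (V : Fin m → T) (Y : Fin (p + 1 + q) → T) =>
      (α fun i => Y (Fin.castAdd q i)) *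
        β (Fin.cons (K V) fun i => Y (Fin.natAdd (p + 1) i))) g X
    have hA' : altSum (fun Z : Fin (m + (p + 1 + q)) → T =>
        α (Fin.cons (K fun i => Z (Fin.castAdd _ i))
          fun i => g (Z (Fin.natAdd m (Fin.cast h (Fin.castAdd (q + 1) i))))) *
          β fun i => g (Z (Fin.natAdd m (Fin.cast h (Fin.natAdd p i))))) X = SA :=
      altSum_reindex ((fin3 m p (q + 1)).trans (finCongr (by omega))) FA X
    have hB' : altSum (fun Z : Fin (m + (p + 1 + q)) → T =>
        (α fun i => g (Z (Fin.natAdd m (Fin.castAdd q i)))) *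
        β (Fin.cons (K fun i => Z (Fin.castAdd _ i))
          fun i => g (Z (Fin.natAdd m (Fin.natAdd (p + 1) i))))) X = SB :=
      altSum_reindex (fin3 m (p + 1) q) FB X
    rw [hA'] at hA
    rw [hB'] at hB
    rw [insAlt_eq_altSum]
    simp_rw [wedgeAlt_cons α β _ _ h, altSum_add, ← smul_eq_mul, altSum_smul]
    simp only [smul_eq_mul] at hA hB ⊢
    rw [hA, hB]
    field_simp
  have hR₁ : wedgeAlt (insAlt g K α) (β.compLinearMap g) (fun i => X (Fin.cast h₁ i)) =
      (1 : ℝ) / (m.factorial * (p.factorial * (q + 1).factorial)) * SA := by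
    have h3 : ((m + p).factorial : ℝ) ≠ 0 := by positivity
    have hA := altSum_altSum_castAdd (fun (V : Fin (m + p) → T) (Y : Fin (q + 1) → T) =>
      α (Fin.cons (K fun i => V (Fin.castAdd p i)) fun i => g (V (Fin.natAdd m i))) *
          β fun i => g (Y i)) fun i => X (Fin.cast h₁ i)
    have hA' : altSum (fun Z : Fin (m + p + (q + 1)) → T =>
        α (Fin.cons (K fun i => Z (Fin.castAdd (q + 1) (Fin.castAdd p i)))
          fun i => g (Z (Fin.castAdd (q + 1) (Fin.natAdd m i)))) *
          β fun i => g (Z (Fin.natAdd (m + p) i))) (fun i => X (Fin.cast h₁ i)) = SA := by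
      refine (altSum_reindex ((sumAssoc _ _ _).symm.trans
        ((Equiv.sumCongr finSumFinEquiv (Equiv.refl _)).trans finSumFinEquiv)) FA _).trans ?_
      refine congrArg (altSum FA) (funext fun i => congrArg X ?_)
      rcases i with i | i | i <;> ext <;> simp [add_assoc]
    rw [hA'] at hA
    have hin : ∀ Z : Fin (m + p + (q + 1)) → T,
        (insAlt g K α fun i => Z (Fin.castAdd (q + 1) i)) *
          (β.compLinearMap g fun j => Z (Fin.natAdd (m + p) j)) =
        (1 : ℝ) / (m.factorial * p.factorial) * altSum (fun V : Fin (m + p) → T =>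
          α (Fin.cons (K fun i => V (Fin.castAdd p i)) fun i => g (V (Fin.natAdd m i))) *
            β fun i => g (Z (Fin.natAdd (m + p) i))) fun i => Z (Fin.castAdd (q + 1) i) := by
      intro Z
      rw [insAlt_eq_altSum, smul_eq_mul, mul_assoc, altSum_mul]
      rfl
    rw [wedgeAlt_eq_altSum]
    simp_rw [hin, mul_altSum]
    rw [hA, smul_eq_mul]
    field_simp
  have hR₂ : wedgeAlt (α.compLinearMap g) (insAlt g K β) (fun i => X (Fin.cast h₂ i)) =
      (-1) ^ (m * (p + 1)) *
        ((1 : ℝ) / (m.factorial * ((p + 1).factorial * q.factorial)) * SB) := by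
    have h3 : ((m + q).factorial : ℝ) ≠ 0 := by positivity
    have hB := altSum_altSum_natAdd (fun (Y : Fin (p + 1) → T) (V : Fin (m + q) → T) =>
      (α fun i => g (Y i)) *
        β (Fin.cons (K fun i => V (Fin.castAdd q i)) fun i => g (V (Fin.natAdd m i)))) id
      fun i => X (Fin.cast h₂ i)
    have hB' : altSum (fun Z : Fin (p + 1 + (m + q)) → T =>
        (α fun i => g (Z (Fin.castAdd (m + q) i))) *
          β (Fin.cons (K fun i => Z (Fin.natAdd (p + 1) (Fin.castAdd q i)))
            fun i => g (Z (Fin.natAdd (p + 1) (Fin.natAdd m i))))) (fun i => X (Fin.cast h₂ i)) =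
        (-1) ^ (m * (p + 1)) * SB :=
      (altSum_reindex ((flip3 m (p + 1) q).trans (fin3 (p + 1) m q)) FB _).trans
        (altSum_flip3 FB X h₂)
    simp only [id] at hB
    rw [hB'] at hB
    have hin : ∀ Z : Fin (p + 1 + (m + q)) → T,
        (α.compLinearMap g fun i => Z (Fin.castAdd (m + q) i)) *
          (insAlt g K β fun j => Z (Fin.natAdd (p + 1) j)) =
        (1 : ℝ) / (m.factorial * q.factorial) * altSum (fun V : Fin (m + q) → T =>
          (α fun i => g (Z (Fin.castAdd (m + q) i))) *
            β (Fin.cons (K fun i => V (Fin.castAdd q i)) fun i => g (V (Fin.natAdd m i))))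
          fun j => Z (Fin.natAdd (p + 1) j) := by
      intro Z
      rw [insAlt_eq_altSum, smul_eq_mul, mul_left_comm, mul_altSum]
      rfl
    rw [wedgeAlt_eq_altSum]
    simp_rw [hin]
    rw [mul_altSum, hB, smul_eq_mul]
    field_simp
  rw [hL, hR₁, hR₂, ← mul_assoc ((-1 : ℝ) ^ ((m + 1) * (p + 1))), ← pow_add,
    show (m + 1) * (p + 1) + m * (p + 1) = 2 * (m * (p + 1)) + (p + 1) by ring, pow_add _ (2 * _),
    (even_two_mul _).neg_one_pow, one_mul]

end PointwiseLeibniz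

/-! ### Insertion of vectors and idempotents on one vector space -/

section PointwiseInsertion

open Equiv

variable {T W W' : Type*} [AddCommGroup T] [Module ℝ T] [AddCommGroup W] [Module ℝ W]
  [AddCommGroup W'] [Module ℝ W']

/-- An alternating map is invariant under antisymmetrization, up to a factorial. -/
theorem altSum_alternating {N N' : Type*} [Fintype N] [DecidableEq N] [Fintype N']
    [DecidableEq N'] (e : N' ≃ N) (α : T [⋀^N']→ₗ[ℝ] W) (X : N → T) :
    altSum (fun Z => α fun i => Z (e i)) X =
      ((Fintype.card N').factorial : ℝ) • α fun i => X (e i) := by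
  refine (altSum_reindex e (fun Z => α Z) X).trans ?_
  have h : ∀ σ : Perm N', ((Perm.sign σ : ℤ) : ℝ) • α (fun i => X (e (σ i))) =
      α fun i => X (e i) := fun σ => by
    refine (congrArg _ (α.map_perm (fun i => X (e i)) σ)).trans ?_
    rw [Units.smul_def, ← Int.cast_smul_eq_zsmul ℝ, smul_smul, ← Int.cast_mul,
      Int.units_coe_mul_self, Int.cast_one, one_smul]
  simp only [altSum]
  simp_rw [h]
  rw [Finset.sum_const, Finset.card_univ, Fintype.card_perm, Nat.cast_smul_eq_nsmul]

theorem wedgeAlt_const_left {q : ℕ} (c : ℝ) (β : T [⋀^Fin q]→ₗ[ℝ] ℝ) (X : Fin (0 + q) → T) :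
    wedgeAlt (AlternatingMap.constOfIsEmpty ℝ T (Fin 0) c) β X =
      c * β fun i => X (Fin.natAdd 0 i) := by
  have h := altSum_alternating (finCongr (zero_add q).symm) β X
  have e' : ∀ i : Fin q, finCongr (zero_add q).symm i = Fin.natAdd 0 i := fun i => by
    ext; simp
  simp only [e', Fintype.card_fin] at h
  rw [wedgeAlt_eq_altSum]
  simp only [AlternatingMap.constOfIsEmpty_apply, Function.const_apply, mul_altSum]
  rw [h, smul_eq_mul]
  have : (q.factorial : ℝ) ≠ 0 := by positivity
  simp
  field_simp

theorem wedgeAlt_const_right {p : ℕ} (c : ℝ) (α : T [⋀^Fin p]→ₗ[ℝ] ℝ) (X : Fin p → T) :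
    wedgeAlt (q := 0) α (AlternatingMap.constOfIsEmpty ℝ T (Fin 0) c) X = c * α X := by
  rw [wedgeAlt_eq_altSum]
  simp only [AlternatingMap.constOfIsEmpty_apply, Function.const_apply, altSum_mul]
  have h := altSum_alternating (Equiv.refl (Fin p)) α X
  simp only [Equiv.refl_apply, Fintype.card_fin] at h
  have h' : altSum (fun Z : Fin (p + 0) → T => α fun i => Z (Fin.castAdd 0 i)) X =
    (p.factorial : ℝ) • α X := h
  rw [h', smul_eq_mul]
  have : (p.factorial : ℝ) ≠ 0 := by positivity
  simp
  field_simp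

theorem insAlt_oneForm (g : T →ₗ[ℝ] T) {m : ℕ} (K : T [⋀^Fin m]→ₗ[ℝ] T)
    (α : T [⋀^Fin 1]→ₗ[ℝ] W) (X : Fin m → T) :
    insAlt (q := 0) g K α X = α fun _ => K X := by
  rw [insAlt_eq_altSum]
  have h := altSum_alternating (Equiv.refl (Fin m))
    (((AlternatingMap.ofSubsingleton ℝ T W (0 : Fin 1)).symm α).compAlternatingMap K) X
  have h' : altSum (fun Z : Fin (m + 0) → T => α (Fin.cons (K fun i => Z (Fin.castAdd 0 i))
      fun j => g (Z (Fin.natAdd m j)))) X = (m.factorial : ℝ) • α fun _ => K X := by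
    simp only [Fintype.card_fin] at h
    refine Eq.trans ?_ h
    refine congrFun (congrArg altSum (funext fun Z => congrArg α (funext fun i => ?_))) X
    rw [Subsingleton.elim i 0]
    rfl
  rw [h', smul_smul]
  have : (m.factorial : ℝ) ≠ 0 := by positivity
  rw [Nat.factorial_zero, Nat.cast_one, mul_one, one_div_mul_cancel this, one_smul]

theorem insAlt_vector (g : T →ₗ[ℝ] T) {q : ℕ} (e : T) (α : T [⋀^Fin (q + 1)]→ₗ[ℝ] W)
    (X : Fin (0 + q) → T) :
    insAlt g (AlternatingMap.constOfIsEmpty ℝ T (Fin 0) e) α X =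
      α (Fin.cons e fun j => g (X (Fin.natAdd 0 j))) := by
  rw [insAlt_eq_altSum]
  have h := altSum_alternating (finCongr (zero_add q).symm) ((α.curryLeft e).compLinearMap g) X
  have e' : ∀ i : Fin q, finCongr (zero_add q).symm i = Fin.natAdd 0 i := fun i => by
    ext; simp
  simp only [e', Fintype.card_fin] at h
  simp only [AlternatingMap.constOfIsEmpty_apply]
  refine (congrArg _ h).trans ?_
  have : (q.factorial : ℝ) ≠ 0 := by positivity
  rw [smul_smul, Nat.factorial_zero, Nat.cast_one, one_mul, one_div_mul_cancel this, one_smul]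
  rfl

/-- If `∑ᵢ θᵢ ⊗ eᵢ = c • Id`, then `∑ᵢ θᵢ ∧ i(eᵢ) α` is `c • α` times the degree of `α`. -/
theorem sum_wedgeAlt_insAlt_vector {ι : Type*} [Fintype ι] (θ : ι → T [⋀^Fin 1]→ₗ[ℝ] ℝ)
    (e : ι → T) (c : ℝ) (hc : ∀ v, ∑ i, θ i (fun _ => v) • e i = c • v) {q : ℕ}
    (α : T [⋀^Fin (q + 1)]→ₗ[ℝ] ℝ) (X : Fin (1 + (0 + q)) → T) (h : q + 1 = 1 + (0 + q)) :
    ∑ i, wedgeAlt (θ i)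
        (insAlt LinearMap.id (AlternatingMap.constOfIsEmpty ℝ T (Fin 0) (e i)) α) X =
      (q + 1) * (c * α fun i => X (Fin.cast h i)) := by
  simp_rw [wedgeAlt_eq_altSum, insAlt_vector, LinearMap.id_apply]
  rw [← Finset.mul_sum]
  have h1 : ∑ i, altSum (fun Z : Fin (1 + (0 + q)) → T =>
      (θ i fun j => Z (Fin.castAdd (0 + q) j)) *
        α (Fin.cons (e i) fun j => Z (Fin.natAdd 1 (Fin.natAdd 0 j)))) X =
      altSum (fun Z : Fin (1 + (0 + q)) → T => c * α fun i => Z (finCongr h i)) X := by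
    simp only [altSum]
    rw [Finset.sum_comm]
    refine Finset.sum_congr rfl fun σ _ => ?_
    rw [← Finset.smul_sum]
    congr 1
    have hlin : ∀ (v : T) (w : Fin q → T), ∑ i, θ i (fun _ => v) * α (Fin.cons (e i) w) =
        c * α (Fin.cons v w) := fun v w => by
      let l : T →ₗ[ℝ] ℝ :=
        { toFun := fun u => α (Fin.cons u w)
          map_add' := fun u u' => α.toMultilinearMap.cons_add w u u'
          map_smul' := fun r u => α.toMultilinearMap.cons_smul w r u }
      have h2 := congrArg l (hc v)
      simp only [map_sum, map_smul, smul_eq_mul] at h2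
      exact h2
    have hj : ∀ j : Fin 1, Fin.castAdd (0 + q) j = Fin.castAdd (0 + q) 0 := fun j => by
      rw [Subsingleton.elim j 0]
    simp_rw [hj]
    rw [hlin]
    congr 2
    funext i
    refine Fin.cases ?_ (fun i => ?_) i
    · exact congrArg (fun k => X (σ k)) (Fin.ext (by simp))
    · exact congrArg (fun k => X (σ k)) (Fin.ext (by simp [add_comm]))
  rw [h1, mul_altSum, altSum_alternating, Nat.factorial_one, Nat.cast_one, one_mul,
    show (0 + q).factorial = q.factorial by rw [zero_add], Fintype.card_fin,
    Nat.factorial_succ, smul_eq_mul]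
  have : (q.factorial : ℝ) ≠ 0 := by positivity
  push_cast
  field_simp
  rfl

theorem insAlt_id_compLinearMap (g : T →ₗ[ℝ] T) {m q : ℕ} (K : T [⋀^Fin m]→ₗ[ℝ] T)
    (α : T [⋀^Fin (q + 1)]→ₗ[ℝ] W) :
    (insAlt LinearMap.id K α).compLinearMap g = insAlt g (K.compLinearMap g) α := by
  ext X
  simp only [AlternatingMap.compLinearMap_apply, insAlt_apply, LinearMap.id_apply]

theorem insAlt_compLinearMap (g : T →ₗ[ℝ] T) (hg : ∀ v, g (g v) = g v) {m q : ℕ}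
    (K : T [⋀^Fin m]→ₗ[ℝ] T) (α : T [⋀^Fin (q + 1)]→ₗ[ℝ] W) :
    (insAlt g K α).compLinearMap g = insAlt g (K.compLinearMap g) α := by
  ext X
  simp only [AlternatingMap.compLinearMap_apply, insAlt_apply, hg]

theorem compLinearMap_cons (g : T →ₗ[ℝ] T) {q : ℕ} (α : T [⋀^Fin (q + 1)]→ₗ[ℝ] W) (y : T)
    (Y : Fin q → T) : α.compLinearMap g (Fin.cons y Y) = α (Fin.cons (g y) fun i => g (Y i)) := by
  rw [AlternatingMap.compLinearMap_apply]
  exact congrArg α (funext fun i => Fin.cases rfl (fun _ => rfl) i)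

theorem insAlt_id_comp (g : T →ₗ[ℝ] T) {m q : ℕ} (K : T [⋀^Fin m]→ₗ[ℝ] T)
    (α : T [⋀^Fin (q + 1)]→ₗ[ℝ] W) :
    insAlt LinearMap.id K (α.compLinearMap g) = insAlt g (g.compAlternatingMap K) α := by
  ext X
  simp only [insAlt_apply, compLinearMap_cons]
  rfl

theorem insAlt_comp (g : T →ₗ[ℝ] T) (hg : ∀ v, g (g v) = g v) {m q : ℕ}
    (K : T [⋀^Fin m]→ₗ[ℝ] T) (α : T [⋀^Fin (q + 1)]→ₗ[ℝ] W) :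
    insAlt g K (α.compLinearMap g) = insAlt g (g.compAlternatingMap K) α := by
  ext X
  simp only [insAlt_apply, compLinearMap_cons, hg]
  rfl

theorem map_insAlt (l : W →ₗ[ℝ] W') (g : T →ₗ[ℝ] T) {m q : ℕ} (K : T [⋀^Fin m]→ₗ[ℝ] T)
    (α : T [⋀^Fin (q + 1)]→ₗ[ℝ] W) :
    l.compAlternatingMap (insAlt g K α) = insAlt g K (l.compAlternatingMap α) := by
  ext X
  simp only [LinearMap.compAlternatingMap_apply, insAlt_apply, map_smul, map_sum]

end PointwiseInsertion

/-! ### Operators on homogeneous forms -/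

section Homogeneous

/-- Homogeneous elements of a degree in `ℤ` are zero, which is the only possibility in negative
degrees, or come from a summand. -/
theorem eq_zero_or_eq_lof {A : ℕ → Type*} [∀ i, AddCommGroup (A i)] [∀ i, Module ℝ (A i)] {q : ℤ}
    {a : ⨁ i, A i} (ha : ∀ j : ℕ, (j : ℤ) ≠ q → a j = 0) :
    a = 0 ∨ ∃ p : ℕ, (p : ℤ) = q ∧ ∃ b : A p, a = DirectSum.lof ℝ ℕ A p b := by
  by_cases h : ∃ p : ℕ, (p : ℤ) = q
  · obtain ⟨p, rfl⟩ := h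
    refine Or.inr ⟨p, rfl, a p, DFinsupp.ext fun j => ?_⟩
    by_cases hj : j = p
    · subst hj
      exact (DirectSum.lof_apply ℝ j (a j)).symm
    · rw [ha j (by exact_mod_cast hj)]
      exact (DirectSum.of_eq_of_ne p j (a p) hj).symm
  · push Not at h
    exact Or.inl (DFinsupp.ext fun j => ha j (h j))

@[elab_as_elim]
theorem lof_induction {A : ℕ → Type*} [∀ i, AddCommGroup (A i)] [∀ i, Module ℝ (A i)]
    {P : (⨁ i, A i) → Prop} (a : ⨁ i, A i) (zero : P 0)
    (lof : ∀ (p : ℕ) (b : A p), P (DirectSum.lof ℝ ℕ A p b))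
    (add : ∀ a b, P a → P b → P (a + b)) : P a :=
  DirectSum.induction_on a zero lof add

theorem lof_apply_ne {A : ℕ → Type*} [∀ i, AddCommGroup (A i)] [∀ i, Module ℝ (A i)] {p j : ℕ}
    (b : A p) (h : (j : ℤ) ≠ p) : DirectSum.lof ℝ ℕ A p b j = 0 :=
  DirectSum.of_eq_of_ne p j b (by exact_mod_cast h)

variable {E : Type*} [NormedAddCommGroup E] [NormedSpace ℝ E]
  {M : Type*} [TopologicalSpace M] [ChartedSpace E M] [IsManifold 𝓘(ℝ, E) ∞ M]

theorem lof_mem_formDeg {p : ℕ} (a : Form E M p) :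
    DirectSum.lof ℝ ℕ (Form E M) p a ∈ formDeg E M p := fun _ hj => lof_apply_ne a hj

theorem lof_mem_vformDeg {p : ℕ} (a : VForm E M p) :
    DirectSum.lof ℝ ℕ (VForm E M) p a ∈ vformDeg E M p := fun _ hj => lof_apply_ne a hj

section Bundle

variable {F : Type*} [NormedAddCommGroup F] [NormedSpace ℝ F] {V : M → Type*}
  [TopologicalSpace (TotalSpace F V)] [∀ x, AddCommGroup (V x)] [∀ x, Module ℝ (V x)]
  [∀ x, TopologicalSpace (V x)] [FiberBundle F V] [VectorBundle ℝ F V]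

theorem bform_ext {p : ℕ} {α β : BForm E M F V p}
    (h : ∀ x (X : Fin p → TangentSpace 𝓘(ℝ, E) x), α.1 x X = β.1 x X) : α = β :=
  Subtype.ext (funext fun x => AlternatingMap.ext (h x))

/-- Homogeneous forms of propositionally equal degrees. -/
theorem lof_congr {p q : ℕ} (h : p = q) {α : BForm E M F V p} {β : BForm E M F V q}
    (hαβ : ∀ x (X : Fin q → TangentSpace 𝓘(ℝ, E) x),
      α.1 x (fun i => X (Fin.cast h i)) = β.1 x X) :
    DirectSum.lof ℝ ℕ (fun p => BForm E M F V p) p α =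
      DirectSum.lof ℝ ℕ (fun p => BForm E M F V p) q β := by
  subst h
  exact congrArg _ (bform_ext hαβ)

theorem add_form_apply {p : ℕ} (α β : BForm E M F V p) (x : M) : (α + β).1 x = α.1 x + β.1 x := rfl

theorem smul_form_apply {p : ℕ} (c : ℝ) (α : BForm E M F V p) (x : M) :
    (c • α).1 x = c • α.1 x := rfl

theorem sum_form_apply {ι : Type*} (s : Finset ι) {p : ℕ} (α : ι → BForm E M F V p) (x : M)
    (X : Fin p → TangentSpace 𝓘(ℝ, E) x) : (∑ i ∈ s, α i).1 x X = ∑ i ∈ s, (α i).1 x X := by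
  classical
  induction s using Finset.induction_on with
  | empty => rfl
  | insert i s hi ih => rw [Finset.sum_insert hi, Finset.sum_insert hi, ← ih]; rfl

theorem insTot_lof_zero (g : BundleEnd E M) {m : ℕ} (K : VForm E M m) (α : BForm E M F V 0) :
    insTot F V g (DirectSum.lof ℝ ℕ (VForm E M) m K)
      (DirectSum.lof ℝ ℕ (fun p => BForm E M F V p) 0 α) = 0 :=
  bilinExt_lof _ _ _ _ _

theorem insTot_lof_succ (g : BundleEnd E M) {m q : ℕ} (K : VForm E M m)
    (α : BForm E M F V (q + 1)) :
    insTot F V g (DirectSum.lof ℝ ℕ (VForm E M) m K)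
      (DirectSum.lof ℝ ℕ (fun p => BForm E M F V p) (q + 1) α) =
      DirectSum.lof ℝ ℕ (fun p => BForm E M F V p) (m + q) (insDeg g m q K α) :=
  bilinExt_lof _ _ _ _ _

end Bundle

theorem wedge_lof {p q : ℕ} (α : Form E M p) (β : Form E M q) :
    wedge E M (DirectSum.lof ℝ ℕ (Form E M) p α) (DirectSum.lof ℝ ℕ (Form E M) q β) =
      DirectSum.lof ℝ ℕ (Form E M) (p + q) (wedgeDeg p q α β) :=
  bilinExt_lof _ _ _ _ _

theorem pull_lof (g : BundleEnd E M) {p : ℕ} (α : Form E M p) :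
    pull g (DirectSum.lof ℝ ℕ (Form E M) p α) =
      DirectSum.lof ℝ ℕ (Form E M) p (precompDeg g p α) :=
  DirectSum.lmap_lof _ _ _

theorem precomp_lof (g : BundleEnd E M) {p : ℕ} (K : VForm E M p) :
    precomp g (DirectSum.lof ℝ ℕ (VForm E M) p K) =
      DirectSum.lof ℝ ℕ (VForm E M) p (precompDeg g p K) :=
  DirectSum.lmap_lof _ _ _

/-- `g ∘ K` for a homogeneous form `K`. -/
def VForm.postcomp (g : BundleEnd E M) {p : ℕ} (K : VForm E M p) : VForm E M p :=
  ⟨fun x => (g.toFun x).compAlternatingMap (K.1 x), fun X => g.smooth' (VForm.onFields K X)⟩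

theorem postcomp_lof (g : BundleEnd E M) {p : ℕ} (K : VForm E M p) :
    postcomp g (DirectSum.lof ℝ ℕ (VForm E M) p K) =
      DirectSum.lof ℝ ℕ (VForm E M) p (VForm.postcomp g K) :=
  DirectSum.lmap_lof _ _ _

theorem oneFormComp_apply (α : Form E M 1) (K : VForms E M) (j : ℕ) (x : M)
    (X : Fin j → TangentSpace 𝓘(ℝ, E) x) :
    (oneFormComp α K j).1 x X = α.1 x fun _ => (K j).1 x X := rfl

/-- `α ∘ K` for a `1`-form `α` and a homogeneous form `K`. -/
def VForm.oneFormComp (α : Form E M 1) {m : ℕ} (K : VForm E M m) : Form E M m :=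
  ⟨fun x => ((AlternatingMap.ofSubsingleton ℝ
      (TangentSpace 𝓘(ℝ, E) x) ℝ (0 : Fin 1)).symm (α.1 x)).compAlternatingMap (K.1 x),
    fun X => α.2 fun _ => VForm.onFields K X⟩

theorem oneFormComp_lof (α : Form E M 1) {m : ℕ} (K : VForm E M m) :
    oneFormComp α (DirectSum.lof ℝ ℕ (VForm E M) m K) =
      DirectSum.lof ℝ ℕ (Form E M) m (VForm.oneFormComp α K) :=
  DirectSum.lmap_lof _ _ _

/-! ### Multiplication by smooth functions -/

/-- The `0`-form given by a smooth function. -/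
def ofFun (φ : C^∞⟮𝓘(ℝ, E), M; ℝ⟯) : Form E M 0 :=
  ⟨fun x => AlternatingMap.constOfIsEmpty ℝ (TangentSpace 𝓘(ℝ, E) x) (Fin 0) (φ x),
    fun _ => (contMDiff_trivial_iff _).2 φ.contMDiff⟩

/-- Vector fields as `TM`-valued `0`-forms. -/
def ofField (X : VField E M) : VForm E M 0 :=
  ⟨fun x => AlternatingMap.constOfIsEmpty ℝ (TangentSpace 𝓘(ℝ, E) x) (Fin 0) (X x),
    fun _ => X.contMDiff⟩

theorem exists_eq_ofFun (α : Form E M 0) : ∃ φ : C^∞⟮𝓘(ℝ, E), M; ℝ⟯, α = ofFun φ := by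
  let X : Fin 0 → VField E M := Fin.elim0
  refine ⟨⟨fun x => α.1 x fun i => X i x, (contMDiff_trivial_iff _).1 (α.2 X)⟩, ?_⟩
  refine bform_ext fun x Y => ?_
  exact congrArg (α.1 x) (Subsingleton.elim _ _)

/-- The product of a smooth function and a `p`-form. -/
def fmulDeg (φ : C^∞⟮𝓘(ℝ, E), M; ℝ⟯) (p : ℕ) : Form E M p →ₗ[ℝ] Form E M p where
  toFun α := ⟨fun x => φ x • α.1 x, fun X =>
    (contMDiff_trivial_iff _).2 (φ.contMDiff.mul ((contMDiff_trivial_iff _).1 (α.2 X)))⟩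
  map_add' α β := Subtype.ext (funext fun x => smul_add (φ x) (α.1 x) (β.1 x))
  map_smul' c α := Subtype.ext (funext fun x => smul_comm (φ x) c (α.1 x))

/-- The product of a smooth function and a form. -/
def fmul (φ : C^∞⟮𝓘(ℝ, E), M; ℝ⟯) : Forms E M →ₗ[ℝ] Forms E M := DirectSum.lmap (fmulDeg φ)

theorem fmul_apply (φ : C^∞⟮𝓘(ℝ, E), M; ℝ⟯) (α : Forms E M) (j : ℕ) (x : M)
    (X : Fin j → TangentSpace 𝓘(ℝ, E) x) : (fmul φ α j).1 x X = φ x * (α j).1 x X := rfl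

theorem fmul_lof (φ : C^∞⟮𝓘(ℝ, E), M; ℝ⟯) {p : ℕ} (α : Form E M p) :
    fmul φ (DirectSum.lof ℝ ℕ (Form E M) p α) =
      DirectSum.lof ℝ ℕ (Form E M) p (fmulDeg φ p α) :=
  DirectSum.lmap_lof _ _ _

theorem wedge_ofFun_left (φ : C^∞⟮𝓘(ℝ, E), M; ℝ⟯) :
    wedge E M (DirectSum.lof ℝ ℕ (Form E M) 0 (ofFun φ)) = fmul φ := by
  refine DirectSum.linearMap_ext ℝ fun q => LinearMap.ext fun β => ?_
  simp only [LinearMap.comp_apply]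
  rw [wedge_lof, fmul_lof]
  refine lof_congr (zero_add q) fun x X => ?_
  refine (wedgeAlt_const_left (T := TangentSpace 𝓘(ℝ, E) x) _ _ _).trans ?_
  refine congrArg (fun Y => φ x * β.1 x Y) (funext fun i => congrArg X (Fin.ext ?_))
  simp

theorem wedge_ofFun_right (φ : C^∞⟮𝓘(ℝ, E), M; ℝ⟯) (α : Forms E M) :
    wedge E M α (DirectSum.lof ℝ ℕ (Form E M) 0 (ofFun φ)) = fmul φ α := by
  revert α
  refine fun α => LinearMap.congr_fun (f := (wedge E M).flip _) (g := fmul φ) ?_ α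
  refine DirectSum.linearMap_ext ℝ fun q => LinearMap.ext fun β => ?_
  simp only [LinearMap.comp_apply, LinearMap.flip_apply]
  rw [wedge_lof, fmul_lof]
  refine congrArg _ (bform_ext fun x X => ?_)
  exact wedgeAlt_const_right (T := TangentSpace 𝓘(ℝ, E) x) _ _ _

theorem pull_ofFun (g : BundleEnd E M) (φ : C^∞⟮𝓘(ℝ, E), M; ℝ⟯) :
    pull g (DirectSum.lof ℝ ℕ (Form E M) 0 (ofFun φ)) =
      DirectSum.lof ℝ ℕ (Form E M) 0 (ofFun φ) :=
  pull_lof _ _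

theorem pull_lof_zero (g : BundleEnd E M) (α : Form E M 0) :
    pull g (DirectSum.lof ℝ ℕ (Form E M) 0 α) = DirectSum.lof ℝ ℕ (Form E M) 0 α := by
  obtain ⟨φ, rfl⟩ := exists_eq_ofFun α
  exact pull_ofFun g φ

theorem ins_fmul (g : BundleEnd E M) (φ : C^∞⟮𝓘(ℝ, E), M; ℝ⟯) (K : VForms E M)
    (α : Forms E M) : ins g K (fmul φ α) = fmul φ (ins g K α) := by
  induction K using lof_induction with
  | zero => simp
  | add K K' h h' => simp only [map_add, LinearMap.add_apply, h, h']
  | lof m K =>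
    induction α using lof_induction with
    | zero => simp
    | add α α' h h' => simp only [map_add, h, h']
    | lof p α =>
      rw [fmul_lof]
      cases p with
      | zero => rw [insTot_lof_zero, insTot_lof_zero, map_zero]
      | succ q =>
        rw [insTot_lof_succ, insTot_lof_succ]
        refine Eq.trans ?_ (fmul_lof _ _).symm
        refine congrArg _ (bform_ext fun x X => ?_)
        exact congrFun (congrArg DFunLike.coe (insAlt_smul_right _ (φ x) (K.1 x) (α.1 x))) X

end Homogeneous

section Operators

variable {E : Type*} [NormedAddCommGroup E] [NormedSpace ℝ E]
  {M : Type*} [TopologicalSpace M] [ChartedSpace E M] [IsManifold 𝓘(ℝ, E) ∞ M]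

/-! ### Relations between insertions and `h^*` -/

/-- Linear operators depending linearly on `K ∈ Ω(M; TM)` agree if they agree on homogeneous forms
of positive degree for homogeneous `K`, provided that they vanish on functions. -/
theorem operator_ext {A B : VForms E M →ₗ[ℝ] Forms E M →ₗ[ℝ] Forms E M}
    (hA : ∀ (m : ℕ) (K : VForm E M m) (α : Form E M 0),
      A (DirectSum.lof ℝ ℕ (VForm E M) m K) (DirectSum.lof ℝ ℕ (Form E M) 0 α) = 0)
    (hB : ∀ (m : ℕ) (K : VForm E M m) (α : Form E M 0),
      B (DirectSum.lof ℝ ℕ (VForm E M) m K) (DirectSum.lof ℝ ℕ (Form E M) 0 α) = 0)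
    (h : ∀ (m q : ℕ) (K : VForm E M m) (α : Form E M (q + 1)),
      A (DirectSum.lof ℝ ℕ (VForm E M) m K) (DirectSum.lof ℝ ℕ (Form E M) (q + 1) α) =
        B (DirectSum.lof ℝ ℕ (VForm E M) m K) (DirectSum.lof ℝ ℕ (Form E M) (q + 1) α)) :
    A = B := by
  refine DirectSum.linearMap_ext ℝ fun m => LinearMap.ext fun K => ?_
  refine DirectSum.linearMap_ext ℝ fun p => LinearMap.ext fun α => ?_
  simp only [LinearMap.comp_apply]
  cases p with
  | zero => rw [hA, hB]
  | succ q => exact h m q K α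

theorem pull_comp_ins_id (g : BundleEnd E M) (K : VForms E M) :
    pull g ∘ₗ ins (BundleEnd.id E M) K = ins g (precomp g K) := by
  refine LinearMap.congr_fun (f := (LinearMap.llcomp ℝ _ _ _ (pull g)) ∘ₗ ins (BundleEnd.id E M))
    (g := ins g ∘ₗ precomp g) (operator_ext ?_ ?_ ?_) K
  · intro m K α
    simp [insTot_lof_zero]
  · intro m K α
    simp [precomp_lof, insTot_lof_zero]
  · intro m q K α
    simp only [LinearMap.comp_apply, LinearMap.llcomp_apply, precomp_lof, insTot_lof_succ,
      pull_lof]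
    exact congrArg _ (Subtype.ext (funext fun x => insAlt_id_compLinearMap _ _ _))

theorem pull_comp_ins (g : BundleEnd E M) (hg : ∀ x v, g.toFun x (g.toFun x v) = g.toFun x v)
    (K : VForms E M) : pull g ∘ₗ ins g K = ins g (precomp g K) := by
  refine LinearMap.congr_fun (f := (LinearMap.llcomp ℝ _ _ _ (pull g)) ∘ₗ ins g)
    (g := ins g ∘ₗ precomp g) (operator_ext ?_ ?_ ?_) K
  · intro m K α
    simp [insTot_lof_zero]
  · intro m K α
    simp [precomp_lof, insTot_lof_zero]
  · intro m q K α
    simp only [LinearMap.comp_apply, LinearMap.llcomp_apply, precomp_lof, insTot_lof_succ,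
      pull_lof]
    exact congrArg _ (Subtype.ext (funext fun x => insAlt_compLinearMap _ (hg x) _ _))

theorem ins_id_comp_pull (g : BundleEnd E M) (K : VForms E M) :
    ins (BundleEnd.id E M) K ∘ₗ pull g = ins g (postcomp g K) := by
  refine LinearMap.congr_fun (f := (LinearMap.lcomp ℝ _ (pull g)) ∘ₗ ins (BundleEnd.id E M))
    (g := ins g ∘ₗ postcomp g) (operator_ext ?_ ?_ ?_) K
  · intro m K α
    simp [pull_lof_zero, insTot_lof_zero]
  · intro m K α
    simp [postcomp_lof, insTot_lof_zero]
  · intro m q K α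
    simp only [LinearMap.comp_apply, LinearMap.lcomp_apply, postcomp_lof, insTot_lof_succ,
      pull_lof]
    exact congrArg _ (Subtype.ext (funext fun x => insAlt_id_comp _ _ _))

theorem ins_comp_pull (g : BundleEnd E M) (hg : ∀ x v, g.toFun x (g.toFun x v) = g.toFun x v)
    (K : VForms E M) : ins g K ∘ₗ pull g = ins g (postcomp g K) := by
  refine LinearMap.congr_fun (f := (LinearMap.lcomp ℝ _ (pull g)) ∘ₗ ins g)
    (g := ins g ∘ₗ postcomp g) (operator_ext ?_ ?_ ?_) K
  · intro m K α
    simp [pull_lof_zero, insTot_lof_zero]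
  · intro m K α
    simp [postcomp_lof, insTot_lof_zero]
  · intro m q K α
    simp only [LinearMap.comp_apply, LinearMap.lcomp_apply, postcomp_lof, insTot_lof_succ,
      pull_lof]
    exact congrArg _ (Subtype.ext (funext fun x => insAlt_comp _ (hg x) _ _))

theorem pull_pull (g : BundleEnd E M) (hg : ∀ x v, g.toFun x (g.toFun x v) = g.toFun x v)
    (α : Forms E M) : pull g (pull g α) = pull g α := by
  refine DFinsupp.ext fun j => bform_ext fun x X => ?_
  change (α j).1 x (fun i => g.toFun x (g.toFun x (X i))) = (α j).1 x fun i => g.toFun x (X i)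
  simp only [hg]

theorem pull_mem_formDeg (g : BundleEnd E M) {q : ℤ} {α : Forms E M} (hα : α ∈ formDeg E M q) :
    pull g α ∈ formDeg E M q := fun j hj => by
  change precompDeg g j (α j) = 0
  rw [hα j hj, map_zero]

/-! ### Insertions on `1`-forms -/

theorem ins_oneForm (g : BundleEnd E M) (K : VForms E M) (α : Form E M 1) :
    ins g K (DirectSum.lof ℝ ℕ (Form E M) 1 α) = oneFormComp α K := by
  refine LinearMap.congr_fun (f := (ins g).flip (DirectSum.lof ℝ ℕ (Form E M) 1 α))
    (g := oneFormComp α) (DirectSum.linearMap_ext ℝ fun m => LinearMap.ext fun K => ?_) K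
  simp only [LinearMap.comp_apply, LinearMap.flip_apply]
  rw [oneFormComp_lof]
  refine (insTot_lof_succ (q := 0) g K α).trans (congrArg _ (bform_ext fun x X => ?_))
  exact insAlt_oneForm (T := TangentSpace 𝓘(ℝ, E) x) _ _ _ _

/-- Composition with a `1`-form turns the action of `i^g(K)` on vector valued forms into the
action on forms. -/
theorem ins_oneFormComp (g : BundleEnd E M) (α : Form E M 1) (K L : VForms E M) :
    ins g K (oneFormComp α L) = oneFormComp α (vins g K L) := by
  induction K using lof_induction with
  | zero => simp
  | add K K' h h' => simp only [map_add, LinearMap.add_apply, h, h']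
  | lof m K =>
    induction L using lof_induction with
    | zero => simp
    | add L L' h h' => simp only [map_add, h, h']
    | lof p L =>
      rw [oneFormComp_lof]
      cases p with
      | zero => rw [insTot_lof_zero, insTot_lof_zero, map_zero]
      | succ q =>
        rw [insTot_lof_succ, insTot_lof_succ]
        refine Eq.trans ?_ (oneFormComp_lof _ _).symm
        refine congrArg _ (Subtype.ext (funext fun x => ?_))
        exact (map_insAlt (T := TangentSpace 𝓘(ℝ, E) x) _ _ _ _).symm

/-! ### Insertions are algebraic derivations -/

/-- For `K` of degree `k + 1` the operator `i^g(K)` has degree `k`. -/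
theorem insTot_mem_degree {F : Type*} [NormedAddCommGroup F] [NormedSpace ℝ F] {V : M → Type*}
    [TopologicalSpace (TotalSpace F V)] [∀ x, AddCommGroup (V x)] [∀ x, Module ℝ (V x)]
    [∀ x, TopologicalSpace (V x)] [FiberBundle F V] [VectorBundle ℝ F V] (g : BundleEnd E M)
    {k q : ℤ} {K : VForms E M} (hK : K ∈ vformDeg E M (k + 1)) {α : ⨁ p, BForm E M F V p}
    (hα : ∀ j : ℕ, (j : ℤ) ≠ q → α j = 0) (j : ℕ) (hj : (j : ℤ) ≠ q + k) :
    insTot F V g K α j = 0 := by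
  rcases eq_zero_or_eq_lof hK with rfl | ⟨m, hm, K, rfl⟩
  · rw [map_zero]
    rfl
  rcases eq_zero_or_eq_lof hα with rfl | ⟨p, rfl, α, rfl⟩
  · rw [map_zero]
    rfl
  cases p with
  | zero => rw [insTot_lof_zero]; rfl
  | succ q =>
    rw [insTot_lof_succ]
    exact lof_apply_ne (A := fun p => BForm E M F V p) _ (by push_cast at hj ⊢; omega)

/-- The Leibniz rule on homogeneous forms. If one of the factors is a function, it amounts to the
linearity of `i^g(K)` over functions. -/
theorem ins_wedge_lof (g : BundleEnd E M) {m p q : ℕ} (K : VForm E M m) (α : Form E M p)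
    (β : Form E M q) :
    ins g (DirectSum.lof ℝ ℕ (VForm E M) m K) (wedge E M (DirectSum.lof ℝ ℕ (Form E M) p α)
        (DirectSum.lof ℝ ℕ (Form E M) q β)) =
      wedge E M (ins g (DirectSum.lof ℝ ℕ (VForm E M) m K) (DirectSum.lof ℝ ℕ (Form E M) p α))
        (pull g (DirectSum.lof ℝ ℕ (Form E M) q β)) +
      (-1 : ℝ) ^ ((m + 1) * p) • wedge E M (pull g (DirectSum.lof ℝ ℕ (Form E M) p α))
        (ins g (DirectSum.lof ℝ ℕ (VForm E M) m K) (DirectSum.lof ℝ ℕ (Form E M) q β)) := by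
  cases p with
  | zero =>
    obtain ⟨φ, rfl⟩ := exists_eq_ofFun α
    rw [pull_ofFun, insTot_lof_zero, wedge_ofFun_left, map_zero, LinearMap.zero_apply, zero_add,
      mul_zero, pow_zero, one_smul]
    exact ins_fmul g φ _ _
  | succ p =>
    cases q with
    | zero =>
      obtain ⟨φ, rfl⟩ := exists_eq_ofFun β
      rw [pull_ofFun, insTot_lof_zero, wedge_ofFun_right, wedge_ofFun_right, map_zero, smul_zero,
        add_zero]
      exact ins_fmul g φ _ _
    | succ q =>
      rw [wedge_lof, pull_lof, pull_lof, insTot_lof_succ, insTot_lof_succ, wedge_lof, wedge_lof]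
      have h₁ : m + p + (q + 1) = m + (p + 1 + q) := by omega
      have h₂ : p + 1 + (m + q) = m + (p + 1 + q) := by omega
      refine (insTot_lof_succ (q := p + 1 + q) g K (wedgeDeg (p + 1) (q + 1) α β)).trans ?_
      -- Transport of forms along an equality of degrees, to compare the three terms in one degree.
      let castForm : ∀ {a b : ℕ} (_ : a = b), Form E M a → Form E M b := fun h γ => h ▸ γ
      have hcast : ∀ {a b : ℕ} (h : a = b) (γ : Form E M a),
          DirectSum.lof ℝ ℕ (Form E M) a γ = DirectSum.lof ℝ ℕ (Form E M) b (castForm h γ) ∧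
          ∀ x X, (castForm h γ).1 x X = γ.1 x fun i => X (Fin.cast h i) := by
        rintro a b rfl γ
        exact ⟨rfl, fun x X => rfl⟩
      rw [(hcast h₁ _).1, (hcast h₂ _).1, ← map_smul, ← map_add]
      refine congrArg _ (bform_ext fun x X => ?_)
      rw [add_form_apply, smul_form_apply]
      refine (insAlt_wedgeAlt (T := TangentSpace 𝓘(ℝ, E) x) (g.toFun x) (K.1 x) (α.1 x) (β.1 x)
        X h₁ h₂).trans ?_
      have e₁ := (hcast h₁ (wedgeDeg _ _ (insDeg g m p K α) (precompDeg g (q + 1) β))).2 x X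
      have e₂ := (hcast h₂ (wedgeDeg _ _ (precompDeg g (p + 1) α) (insDeg g m q K β))).2 x X
      exact congrArg₂ (fun a b : ℝ => a + (-1) ^ ((m + 1) * (p + 1)) * b) e₁.symm e₂.symm

theorem ins_isAlgebraicDerivation (g : BundleEnd E M) {k : ℤ} {K : VForms E M}
    (hK : K ∈ vformDeg E M (k + 1)) : IsAlgebraicDerivation g k (ins g K) where
  degree q α hα := insTot_mem_degree g hK hα
  leibniz q α hα β := by
    rcases eq_zero_or_eq_lof hK with rfl | ⟨m, hm, K, rfl⟩
    · simp
    rcases eq_zero_or_eq_lof hα with rfl | ⟨p, rfl, α, rfl⟩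
    · simp
    -- Here `k = m - 1`, and `m - 1` and `m + 1` have the same parity.
    have hsign : (-1 : ℝ) ^ (k * p) = (-1) ^ ((m + 1) * p) := by
      rw [show k * p = (((m + 1) * p : ℕ) : ℤ) + 2 * (-p) by
        push_cast
        rw [hm]
        ring, zpow_add₀ (by norm_num), zpow_mul _ 2, zpow_natCast]
      norm_num
    rw [hsign]
    induction β using lof_induction with
    | zero => simp
    | add β β' h h' =>
      simp only [map_add, h, h', smul_add]
      abel
    | lof q β => exact ins_wedge_lof g K α β
  algebraic f hf := by
    rcases eq_zero_or_eq_lof hf with rfl | ⟨p, hp, f, rfl⟩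
    · rw [map_zero]
    obtain rfl : p = 0 := by exact_mod_cast hp
    rcases eq_zero_or_eq_lof hK with rfl | ⟨m, hm, K, rfl⟩
    · simp
    · exact insTot_lof_zero g K f

end Operators

section Derivations

variable {E : Type*} [NormedAddCommGroup E] [NormedSpace ℝ E]
  {M : Type*} [TopologicalSpace M] [ChartedSpace E M] [IsManifold 𝓘(ℝ, E) ∞ M]

/-! ### Algebraic derivations and vector valued forms -/

/-- Algebraic derivations over `g^*` are linear over functions, since `g^*` fixes functions. -/
theorem IsAlgebraicDerivation.map_fmul {g : BundleEnd E M} {k : ℤ}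
    {D : Forms E M →ₗ[ℝ] Forms E M} (hD : IsAlgebraicDerivation g k D)
    (φ : C^∞⟮𝓘(ℝ, E), M; ℝ⟯) (α : Forms E M) : D (fmul φ α) = fmul φ (D α) := by
  have h0 : DirectSum.lof ℝ ℕ (Form E M) 0 (ofFun φ) ∈ formDeg E M 0 := lof_mem_formDeg _
  have h := hD.leibniz 0 _ h0 α
  rw [hD.algebraic _ h0, pull_ofFun, wedge_ofFun_left, map_zero, LinearMap.zero_apply, zero_add,
    mul_zero, zpow_zero, one_smul] at h
  exact h

/-- Two forms agree if around each point they agree after multiplication by a function which does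
not vanish there. -/
theorem forms_ext_fmul {α β : Forms E M}
    (h : ∀ x : M, ∃ φ : C^∞⟮𝓘(ℝ, E), M; ℝ⟯, φ x ≠ 0 ∧ fmul φ α = fmul φ β) : α = β := by
  refine DFinsupp.ext fun j => bform_ext fun x X => ?_
  obtain ⟨φ, hφ, hαβ⟩ := h x
  have h1 : φ x * (α j).1 x X = φ x * (β j).1 x X := by
    rw [← fmul_apply, ← fmul_apply, hαβ]
  exact mul_left_cancel₀ hφ h1

/-- Locally, a form of positive degree is a sum of wedge products of `1`-forms with its interior
products. -/
theorem sum_wedge_ins_ofField {ι : Type*} [Fintype ι] (φ : C^∞⟮𝓘(ℝ, E), M; ℝ⟯)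
    (e : ι → VField E M) (θ : ι → Form E M 1)
    (h : ∀ x (v : TangentSpace 𝓘(ℝ, E) x), ∑ i, (θ i).1 x (fun _ => v) • e i x = φ x • v)
    {q : ℕ} (α : Form E M (q + 1)) :
    ∑ i, wedge E M (DirectSum.lof ℝ ℕ (Form E M) 1 (θ i))
        (ins (BundleEnd.id E M) (DirectSum.lof ℝ ℕ (VForm E M) 0 (ofField (e i)))
          (DirectSum.lof ℝ ℕ (Form E M) (q + 1) α)) =
      ((q + 1 : ℕ) : ℝ) • fmul φ (DirectSum.lof ℝ ℕ (Form E M) (q + 1) α) := by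
  simp_rw [insTot_lof_succ, wedge_lof]
  rw [← map_sum, fmul_lof, ← map_smul]
  have hq : q + 1 = 1 + (0 + q) := by omega
  symm
  refine lof_congr hq fun x X => ?_
  refine Eq.trans ?_ (sum_form_apply _ _ _ _).symm
  have := sum_wedgeAlt_insAlt_vector (T := TangentSpace 𝓘(ℝ, E) x) (fun i => (θ i).1 x)
    (fun i => e i x) (φ x) (h x) (α.1 x) X hq
  refine Eq.trans ?_ this.symm
  rw [← Nat.cast_succ]
  rfl

/-- Algebraic derivations are determined by their values on `1`-forms: they are local, and locally
`Ω(M)` is generated by functions and `1`-forms. -/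
theorem IsAlgebraicDerivation.ext [FiniteDimensional ℝ E] [T2Space M] {g : BundleEnd E M} {k : ℤ}
    {D D' : Forms E M →ₗ[ℝ] Forms E M} (hD : IsAlgebraicDerivation g k D)
    (hD' : IsAlgebraicDerivation g k D')
    (h : ∀ α : Form E M 1, D (DirectSum.lof ℝ ℕ (Form E M) 1 α) =
      D' (DirectSum.lof ℝ ℕ (Form E M) 1 α)) : D = D' := by
  have key : ∀ (p : ℕ), ∀ α ∈ formDeg E M p, D α = D' α := by
    intro p
    induction p with
    | zero => exact fun α hα => (hD.algebraic α hα).trans (hD'.algebraic α hα).symm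
    | succ q ih =>
      intro α hα
      rcases eq_zero_or_eq_lof hα with rfl | ⟨p, hp, α, rfl⟩
      · rw [map_zero, map_zero]
      obtain rfl : p = q + 1 := by exact_mod_cast hp
      refine forms_ext_fmul fun x => ?_
      obtain ⟨φ, e, θ, hφ, hsum⟩ := exists_bump_frame (E := E) x
      have hx : φ x = 1 := hφ.eq_of_nhds
      refine ⟨φ, by rw [hx]; exact one_ne_zero, ?_⟩
      have hq : ((q + 1 : ℕ) : ℝ) ≠ 0 := by positivity
      refine smul_right_injective _ hq ?_
      change ((q + 1 : ℕ) : ℝ) • fmul φ (D _) = ((q + 1 : ℕ) : ℝ) • fmul φ (D' _)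
      rw [← hD.map_fmul, ← hD'.map_fmul, ← D.map_smul, ← D'.map_smul,
        ← sum_wedge_ins_ofField φ e θ hsum α, map_sum, map_sum]
      refine Finset.sum_congr rfl fun i _ => ?_
      rw [hD.leibniz 1 _ (lof_mem_formDeg _), hD'.leibniz 1 _ (lof_mem_formDeg _), h, ih]
      rw [insTot_lof_succ]
      exact fun j hj => lof_apply_ne (A := Form E M) _ (by push_cast; omega)
  refine DirectSum.linearMap_ext ℝ fun p => LinearMap.ext fun α => ?_
  exact key p _ (lof_mem_formDeg α)

/-- There are enough global `1`-forms to detect vector valued forms. -/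
theorem eq_zero_of_oneFormComp [FiniteDimensional ℝ E] [T2Space M] {K : VForms E M}
    (h : ∀ α : Form E M 1, oneFormComp α K = 0) : K = 0 := by
  refine DFinsupp.ext fun j => bform_ext fun x X => ?_
  obtain ⟨φ, e, θ, hφ, hsum⟩ := exists_bump_frame (E := E) x
  have hx : φ x = 1 := hφ.eq_of_nhds
  have h1 := hsum x ((K j).1 x X)
  rw [hx, one_smul] at h1
  refine h1.symm.trans (Finset.sum_eq_zero fun i _ => ?_)
  have h2 : (θ i).1 x (fun _ => (K j).1 x X) = 0 := by
    rw [← oneFormComp_apply, h]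
    rfl
  refine (congrArg (fun c : ℝ => c • e i x) h2).trans (zero_smul _ _)

/-- The vector valued form `K` is determined by the insertion operator `i^g(K)`. -/
theorem ins_injective [FiniteDimensional ℝ E] [T2Space M] (g : BundleEnd E M) :
    Function.Injective (ins g) := by
  refine (injective_iff_map_eq_zero _).2 fun K hK => eq_zero_of_oneFormComp fun α => ?_
  rw [← ins_oneForm g, hK, LinearMap.zero_apply]

theorem alternating_one_apply_sum_smul {T : Type*} [AddCommGroup T] [Module ℝ T] {ι : Type*}
    [Fintype ι] (α : T [⋀^Fin 1]→ₗ[ℝ] ℝ) (c : ι → ℝ) (e : ι → T) :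
    α (fun _ => ∑ i, c i • e i) = ∑ i, α (fun _ => e i) * c i := by
  have h := map_sum ((AlternatingMap.ofSubsingleton ℝ T ℝ (0 : Fin 1)).symm α)
    (fun i => c i • e i) Finset.univ
  simp only [map_smul, smul_eq_mul] at h
  refine h.trans (Finset.sum_congr rfl fun i _ => mul_comm _ _)

/-- A `C^∞(M)`-linear operator from `1`-forms to `m`-forms is composition with a `TM`-valued
`m`-form, which can be read off from the values on a local frame. -/
theorem exists_vform_of_tensorial [FiniteDimensional ℝ E] [T2Space M] {m : ℕ}
    (d : Form E M 1 →ₗ[ℝ] Form E M m)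
    (hd : ∀ (φ : C^∞⟮𝓘(ℝ, E), M; ℝ⟯) α, d (fmulDeg φ 1 α) = fmulDeg φ m (d α)) :
    ∃ K : VForm E M m, ∀ α, d α = VForm.oneFormComp α K := by
  choose φ e θ hφ hsum using fun x : M => exists_bump_frame (E := E) x
  -- `φ α = ∑ α(eᵢ) θᵢ` and linearity over functions.
  have hexp : ∀ (x₀ : M) (α : Form E M 1) (x : M) (X : Fin m → TangentSpace 𝓘(ℝ, E) x),
      φ x₀ x * (d α).1 x X =
        ∑ i, α.1 x (fun _ => e x₀ i x) * (d (θ x₀ i)).1 x X := by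
    intro x₀ α x X
    let f : Fin (Module.finrank ℝ E) → C^∞⟮𝓘(ℝ, E), M; ℝ⟯ := fun i =>
      ⟨fun x => α.1 x fun _ => e x₀ i x, (contMDiff_trivial_iff _).1 (α.2 fun _ => e x₀ i)⟩
    have h1 : fmulDeg (φ x₀) 1 α = ∑ i, fmulDeg (f i) 1 (θ x₀ i) := by
      refine bform_ext fun y Y => ?_
      rw [sum_form_apply]
      have h2 := alternating_one_apply_sum_smul (T := TangentSpace 𝓘(ℝ, E) y) (α.1 y)
        (fun i => (θ x₀ i).1 y fun _ => Y 0) fun i => e x₀ i y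
      rw [hsum] at h2
      have hY : (fun _ => Y 0) = Y := funext fun i => congrArg Y (Subsingleton.elim 0 i)
      have h3 := ((AlternatingMap.ofSubsingleton ℝ (TangentSpace 𝓘(ℝ, E) y) ℝ (0 : Fin 1)).symm
        (α.1 y)).map_smul (φ x₀ y) (Y 0)
      have h4 := h3.symm.trans h2
      rw [hY] at h4
      refine Eq.trans ?_ h4
      exact congrArg (fun Z => φ x₀ y * α.1 y Z) hY.symm
    have h2 := congrArg d h1
    rw [hd, map_sum] at h2
    simp_rw [hd] at h2
    have h3 := congrArg (fun β : Form E M m => β.1 x X) h2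
    simp only [sum_form_apply] at h3
    exact h3
  -- At each point `x` use the frame which is adapted to `x`, so that `φ x = 1`.
  let κ : ∀ x : M, TangentSpace 𝓘(ℝ, E) x [⋀^Fin m]→ₗ[ℝ] TangentSpace 𝓘(ℝ, E) x := fun x =>
    ∑ i, (LinearMap.toSpanSingleton ℝ (TangentSpace 𝓘(ℝ, E) x) (e x i x)).compAlternatingMap
      (N := ℝ) ((d (θ x i)).1 x)
  have hκ : ∀ x (X : Fin m → TangentSpace 𝓘(ℝ, E) x), κ x X =
      ∑ i, (d (θ x i)).1 x X • e x i x := by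
    intro x X
    have h := map_sum (AddMonoidHom.mk' (fun β : TangentSpace 𝓘(ℝ, E) x [⋀^Fin m]→ₗ[ℝ]
      TangentSpace 𝓘(ℝ, E) x => β X) fun _ _ => rfl) (fun i => (LinearMap.toSpanSingleton ℝ
        (TangentSpace 𝓘(ℝ, E) x) (e x i x)).compAlternatingMap (N := ℝ) ((d (θ x i)).1 x))
      Finset.univ
    exact h
  have hκα : ∀ (α : Form E M 1) (x : M) (X : Fin m → TangentSpace 𝓘(ℝ, E) x),
      (d α).1 x X = α.1 x fun _ => κ x X := by
    intro α x X
    have h1 := hexp x α x X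
    rw [(hφ x).eq_of_nhds] at h1
    simp only [hκ]
    refine (one_mul _).symm.trans (h1.trans ?_)
    exact (alternating_one_apply_sum_smul (T := TangentSpace 𝓘(ℝ, E) x) (α.1 x) _ _).symm
  -- The frame adapted to `x₀` computes `κ` in a neighbourhood of `x₀`, which gives smoothness.
  have hloc : ∀ (x₀ x : M) (X : Fin m → TangentSpace 𝓘(ℝ, E) x),
      φ x₀ x • κ x X = ∑ i, (d (θ x₀ i)).1 x X • e x₀ i x := by
    intro x₀ x X
    rw [← hsum]
    exact Finset.sum_congr rfl fun i _ => congrArg (fun c : ℝ => c • e x₀ i x) (hκα _ _ _).symm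
  refine ⟨⟨κ, fun X x₀ => ?_⟩, fun α => bform_ext fun x X => hκα α x X⟩
  have hsm : ContMDiff 𝓘(ℝ, E) (𝓘(ℝ, E).prod 𝓘(ℝ, E)) ∞ fun x =>
      TotalSpace.mk' E (E := (TangentSpace 𝓘(ℝ, E) : M → Type _)) x
        (∑ i, (show ℝ from (d (θ x₀ i)).1 x fun j => X j x) • e x₀ i x) :=
    ContMDiff.sum_section fun i _ => ContMDiff.smul_section
      ((contMDiff_trivial_iff _).1 ((d (θ x₀ i)).2 X)) (e x₀ i).contMDiff
  refine (hsm x₀).congr_of_eventuallyEq ?_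
  filter_upwards [hφ x₀] with x hx
  have h1 := hloc x₀ x fun j => X j x
  rw [hx, Pi.one_apply, one_smul] at h1
  exact congrArg (TotalSpace.mk' E (E := (TangentSpace 𝓘(ℝ, E) : M → Type _)) x) h1

theorem IsAlgebraicDerivation.exists_vform [FiniteDimensional ℝ E] [T2Space M]
    {g : BundleEnd E M} {k : ℤ} {D : Forms E M →ₗ[ℝ] Forms E M}
    (hD : IsAlgebraicDerivation g k D) :
    ∃ K ∈ vformDeg E M (k + 1), ∀ α : Form E M 1,
      D (DirectSum.lof ℝ ℕ (Form E M) 1 α) = oneFormComp α K := by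
  have hdeg : ∀ α : Form E M 1, D (DirectSum.lof ℝ ℕ (Form E M) 1 α) ∈ formDeg E M (k + 1) :=
    fun α => add_comm k 1 ▸ hD.degree 1 _ (lof_mem_formDeg α)
  by_cases hk : ∃ m : ℕ, (m : ℤ) = k + 1
  · obtain ⟨m, hm⟩ := hk
    obtain ⟨K, hK⟩ := exists_vform_of_tensorial
      (DirectSum.component ℝ ℕ (Form E M) m ∘ₗ D ∘ₗ DirectSum.lof ℝ ℕ (Form E M) 1)
      (fun φ α => by
        have h := congrArg (DirectSum.component ℝ ℕ (Form E M) m)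
          (hD.map_fmul φ (DirectSum.lof ℝ ℕ (Form E M) 1 α))
        rw [fmul_lof] at h
        exact h)
    refine ⟨DirectSum.lof ℝ ℕ (VForm E M) m K, hm ▸ lof_mem_vformDeg K, fun α => ?_⟩
    rw [oneFormComp_lof, ← hK]
    rcases eq_zero_or_eq_lof (hdeg α) with h | ⟨p, hp, β, h⟩
    · simp [h]
    · obtain rfl : p = m := by omega
      simp [h, DirectSum.component.lof_self]
  -- In degrees `k < -1` the derivation vanishes on `1`-forms.
  · refine ⟨0, Submodule.zero_mem _, fun α => ?_⟩
    rcases eq_zero_or_eq_lof (hdeg α) with h | ⟨p, hp, β, h⟩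
    · rw [h, map_zero]
    · exact absurd ⟨p, hp⟩ hk

end Derivations

section Bracket

variable {E : Type*} [NormedAddCommGroup E] [NormedSpace ℝ E]
  {M : Type*} [TopologicalSpace M] [ChartedSpace E M] [IsManifold 𝓘(ℝ, E) ∞ M]

/-! ### Graded commutators and the bracket -/

theorem neg_one_zpow_mul_self (n : ℤ) : (-1 : ℝ) ^ n * (-1) ^ n = 1 := by
  rw [← mul_zpow]
  simp

theorem neg_one_zpow_add (a b : ℤ) : (-1 : ℝ) ^ (a + b) = (-1) ^ a * (-1) ^ b :=
  zpow_add₀ (by norm_num) a b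

theorem Connection.h_idem {F : ∀ x : M, Submodule ℝ (TangentSpace 𝓘(ℝ, E) x)}
    (c : Connection E M F) (x : M) (v : TangentSpace 𝓘(ℝ, E) x) :
    c.h.toFun x (c.h.toFun x v) = c.h.toFun x v := by
  have h : c.φ.toFun x (c.φ.toFun x v) = c.φ.toFun x v :=
    (c.isProj x).map_id _ ((c.isProj x).map_mem v)
  change (v - c.φ.toFun x v) - c.φ.toFun x (v - c.φ.toFun x v) = v - c.φ.toFun x v
  rw [map_sub, h, sub_self, sub_zero]

theorem formDeg_congr {q r : ℤ} (h : q = r) {α : Forms E M} (hα : α ∈ formDeg E M q) :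
    α ∈ formDeg E M r := h ▸ hα

/-- The mixed terms `g^* D₁ α ∧ g^* D₂ β` and `g^* D₂ α ∧ g^* D₁ β` cancel, because `D₁` and `D₂`
commute with `g^*`, and the other terms are over `g^* ∘ g^* = g^*`. -/
theorem isDerivation_gradedComm {g : BundleEnd E M}
    (hg : ∀ x v, g.toFun x (g.toFun x v) = g.toFun x v) {k l : ℤ}
    {D₁ D₂ : Forms E M →ₗ[ℝ] Forms E M} (h₁ : IsDerH g k D₁) (h₂ : IsDerH g l D₂) :
    IsDerivation g (k + l) (gradedComm k l D₁ D₂) where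
  degree q α hα := Submodule.sub_mem _
    (formDeg_congr (by ring) (h₁.1.degree _ _ (h₂.1.degree _ _ hα)))
    (Submodule.smul_mem _ _ (formDeg_congr (by ring) (h₂.1.degree _ _ (h₁.1.degree _ _ hα))))
  leibniz q α hα β := by
    have c₁ : ∀ γ, D₁ (pull g γ) = pull g (D₁ γ) := LinearMap.congr_fun h₁.2
    have c₂ : ∀ γ, D₂ (pull g γ) = pull g (D₂ γ) := LinearMap.congr_fun h₂.2
    have e₁ : D₁ (D₂ (wedge E M α β)) = _ :=
      (congrArg D₁ (h₂.1.leibniz q α hα β)).trans (by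
        rw [map_add, map_smul, h₁.1.leibniz _ _ (h₂.1.degree _ _ hα),
          h₁.1.leibniz _ _ (pull_mem_formDeg g hα), pull_pull g hg, pull_pull g hg, c₁, c₁])
    have e₂ : D₂ (D₁ (wedge E M α β)) = _ :=
      (congrArg D₂ (h₁.1.leibniz q α hα β)).trans (by
        rw [map_add, map_smul, h₂.1.leibniz _ _ (h₁.1.degree _ _ hα),
          h₂.1.leibniz _ _ (pull_mem_formDeg g hα), pull_pull g hg, pull_pull g hg, c₂, c₂])
    simp only [gradedComm, LinearMap.sub_apply, LinearMap.comp_apply, LinearMap.smul_apply, e₁, e₂,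
      map_sub, map_smul, mul_add, add_mul, neg_one_zpow_add, mul_comm l k]
    have hs := neg_one_zpow_mul_self (k * l)
    generalize (-1 : ℝ) ^ (k * l) = s at *
    generalize (-1 : ℝ) ^ (k * q) = a
    generalize (-1 : ℝ) ^ (l * q) = b
    rcases mul_self_eq_one_iff.1 hs with rfl | rfl <;> module

theorem gradedComm_comp_pull {g : BundleEnd E M} {k l : ℤ} {D₁ D₂ : Forms E M →ₗ[ℝ] Forms E M}
    (h₁ : D₁ ∘ₗ pull g = pull g ∘ₗ D₁) (h₂ : D₂ ∘ₗ pull g = pull g ∘ₗ D₂) :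
    gradedComm k l D₁ D₂ ∘ₗ pull g = pull g ∘ₗ gradedComm k l D₁ D₂ := by
  simp only [gradedComm, LinearMap.sub_comp, LinearMap.comp_sub, LinearMap.smul_comp,
    LinearMap.comp_smul, LinearMap.comp_assoc, h₁, h₂]
  simp only [← LinearMap.comp_assoc, h₁, h₂]

theorem gradedComm_jacobi (k l n : ℤ) (A B C : Forms E M →ₗ[ℝ] Forms E M) :
    gradedComm k (l + n) A (gradedComm l n B C) =
      gradedComm (k + l) n (gradedComm k l A B) C +
        (-1 : ℝ) ^ (k * l) • gradedComm l (k + n) B (gradedComm k n A C) := by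
  refine LinearMap.ext fun α => ?_
  simp only [gradedComm, LinearMap.comp_apply, LinearMap.add_apply, LinearMap.sub_apply,
    LinearMap.smul_apply, map_sub, map_smul, mul_add, add_mul, neg_one_zpow_add, mul_comm l k]
  have hs := neg_one_zpow_mul_self (k * l)
  generalize (-1 : ℝ) ^ (k * l) = s at *
  generalize (-1 : ℝ) ^ (k * n) = a
  generalize (-1 : ℝ) ^ (l * n) = b
  rcases mul_self_eq_one_iff.1 hs with rfl | rfl <;> module

theorem ins_isDerH {F : ∀ x : M, Submodule ℝ (TangentSpace 𝓘(ℝ, E) x)} (c : Connection E M F)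
    {k : ℤ} {K : VForms E M} (hK : K ∈ equivariant c.h (k + 1)) : IsDerH c.h k (ins c.h K) := by
  refine ⟨(ins_isAlgebraicDerivation c.h hK.1).toIsDerivation, ?_⟩
  rw [ins_comp_pull c.h c.h_idem, pull_comp_ins c.h c.h_idem]
  exact congrArg _ hK.2

theorem bracket_mem_vformDeg (g : BundleEnd E M) {k l : ℤ} {K L : VForms E M}
    (hK : K ∈ vformDeg E M (k + 1)) (hL : L ∈ vformDeg E M (l + 1)) :
    bracket g k l K L ∈ vformDeg E M (k + l + 1) := by
  refine Submodule.sub_mem _ ?_ (Submodule.smul_mem _ _ ?_)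
  · exact fun j hj => insTot_mem_degree g hK hL j (by omega)
  · exact fun j hj => insTot_mem_degree g hL hK j (by omega)

/-- `K ↦ i^h(K)` is compatible with the brackets: both sides are algebraic derivations with
the same values on `1`-forms. -/
theorem ins_bracket [FiniteDimensional ℝ E] [T2Space M]
    {F : ∀ x : M, Submodule ℝ (TangentSpace 𝓘(ℝ, E) x)} (c : Connection E M F)
    {k l : ℤ} {K L : VForms E M} (hK : K ∈ equivariant c.h (k + 1))
    (hL : L ∈ equivariant c.h (l + 1)) :
    ins c.h (bracket c.h k l K L) = gradedComm k l (ins c.h K) (ins c.h L) := by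
  refine IsAlgebraicDerivation.ext (g := c.h) (k := k + l)
    (ins_isAlgebraicDerivation c.h (bracket_mem_vformDeg c.h hK.1 hL.1))
    ⟨isDerivation_gradedComm c.h_idem (ins_isDerH c hK) (ins_isDerH c hL), fun f hf => ?_⟩
    fun α => ?_
  · simp only [gradedComm, LinearMap.sub_apply, LinearMap.comp_apply, LinearMap.smul_apply,
      (ins_isAlgebraicDerivation c.h hK.1).algebraic f hf,
      (ins_isAlgebraicDerivation c.h hL.1).algebraic f hf, map_zero, smul_zero, sub_zero]
  · simp only [gradedComm, LinearMap.sub_apply, LinearMap.comp_apply, LinearMap.smul_apply,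
      ins_oneForm, ins_oneFormComp, bracket, map_sub, map_smul, LinearMap.flip_apply]

theorem ins_comp_pull_sub (g : BundleEnd E M)
    (hg : ∀ x v, g.toFun x (g.toFun x v) = g.toFun x v) (K : VForms E M) :
    ins g K ∘ₗ pull g - pull g ∘ₗ ins g K = ins g (postcomp g K - precomp g K) := by
  rw [ins_comp_pull g hg, pull_comp_ins g hg, map_sub]

theorem ins_commutes_iff [FiniteDimensional ℝ E] [T2Space M] (g : BundleEnd E M)
    (hg : ∀ x v, g.toFun x (g.toFun x v) = g.toFun x v) (K : VForms E M) :
    ins g K ∘ₗ pull g - pull g ∘ₗ ins g K = 0 ↔ postcomp g K = precomp g K := by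
  rw [ins_comp_pull_sub g hg, map_eq_zero_iff _ (ins_injective g), sub_eq_zero]

theorem bracket_mem_equivariant [FiniteDimensional ℝ E] [T2Space M]
    {F : ∀ x : M, Submodule ℝ (TangentSpace 𝓘(ℝ, E) x)} (c : Connection E M F)
    {k l : ℤ} {K L : VForms E M} (hK : K ∈ equivariant c.h (k + 1))
    (hL : L ∈ equivariant c.h (l + 1)) :
    bracket c.h k l K L ∈ equivariant c.h (k + l + 1) := by
  refine ⟨bracket_mem_vformDeg c.h hK.1 hL.1, (ins_commutes_iff c.h c.h_idem _).1 ?_⟩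
  rw [ins_bracket c hK hL, sub_eq_zero]
  exact gradedComm_comp_pull (ins_isDerH c hK).2 (ins_isDerH c hL).2

theorem isGradedLieAlgebra_bracket [FiniteDimensional ℝ E] [T2Space M]
    {F : ∀ x : M, Submodule ℝ (TangentSpace 𝓘(ℝ, E) x)} (c : Connection E M F) :
    IsGradedLieAlgebra (fun k => equivariant c.h (k + 1)) (bracket c.h) where
  mem k l K hK L hL := bracket_mem_equivariant c hK hL
  skew k l K _ L _ := by
    simp only [bracket, LinearMap.sub_apply, LinearMap.smul_apply, LinearMap.flip_apply, smul_sub,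
      smul_smul, mul_comm l k, neg_one_zpow_mul_self, one_smul, neg_sub]
  jacobi k l n K hK L hL N hN := by
    refine ins_injective c.h ?_
    have hLN := bracket_mem_equivariant c hL hN
    have hKL := bracket_mem_equivariant c hK hL
    have hKN := bracket_mem_equivariant c hK hN
    rw [map_add, map_smul, ins_bracket c hK hLN, ins_bracket c hL hN, ins_bracket c hKL hN,
      ins_bracket c hK hL, ins_bracket c hL hKN, ins_bracket c hK hN, gradedComm_jacobi]

end Bracket

end

end HDer

theorem lemma2p3 {E : Type*} [NormedAddCommGroup E] [NormedSpace ℝ E] [FiniteDimensional ℝ E]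
    {M : Type*} [TopologicalSpace M] [T2Space M] [ChartedSpace E M]
    [IsManifold 𝓘(ℝ, E) ∞ M]
    {F : ∀ x : M, Submodule ℝ (TangentSpace 𝓘(ℝ, E) x)} (c : HDer.Connection E M F) :
    -- 1. algebraic derivations over `h^*` are exactly the `i^h(K)`, and the explicit formula
    (∀ (k : ℤ) (D : HDer.Forms E M →ₗ[ℝ] HDer.Forms E M),
      HDer.IsAlgebraicDerivation c.h k D →
        ∃! K : HDer.VForms E M, K ∈ HDer.vformDeg E M (k + 1) ∧
          ∀ α : HDer.Form E M 1,
            D (DirectSum.lof ℝ ℕ (HDer.Form E M) 1 α) = HDer.oneFormComp α K) ∧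
    (∀ (k : ℤ), ∀ K ∈ HDer.vformDeg E M (k + 1),
      ∀ D : HDer.Forms E M →ₗ[ℝ] HDer.Forms E M,
        (HDer.IsAlgebraicDerivation c.h k D ∧
          ∀ α : HDer.Form E M 1,
            D (DirectSum.lof ℝ ℕ (HDer.Form E M) 1 α) = HDer.oneFormComp α K) ↔
        D = HDer.ins c.h K) ∧
    (∀ (m q : ℕ) (K : HDer.VForm E M m) (α : HDer.Form E M (q + 1)) (x : M)
      (X : Fin (m + q) → TangentSpace 𝓘(ℝ, E) x),
      ((HDer.ins c.h (DirectSum.lof ℝ ℕ (HDer.VForm E M) m K)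
          (DirectSum.lof ℝ ℕ (HDer.Form E M) (q + 1) α)) (m + q)).1 x X =
        ((1 : ℝ) / (m.factorial * q.factorial)) *
          ∑ σ : Equiv.Perm (Fin (m + q)), ((Equiv.Perm.sign σ : ℤ) : ℝ) *
            α.1 x (Fin.cons (K.1 x fun i => X (σ (Fin.castAdd q i)))
              fun j => c.h.toFun x (X (σ (Fin.natAdd m j))))) ∧
    -- 2. `i^h(K)` commutes with `h^*` iff `h ∘ K = K ∘ Λh`
    (∀ (k : ℤ), ∀ K ∈ HDer.vformDeg E M (k + 1),
      HDer.ins c.h K ∘ₗ HDer.pull c.h - HDer.pull c.h ∘ₗ HDer.ins c.h K = 0 ↔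
        HDer.postcomp c.h K = HDer.precomp c.h K) ∧
    -- 3. the bracket
    (∀ k l : ℤ, ∀ K ∈ HDer.equivariant c.h (k + 1), ∀ L ∈ HDer.equivariant c.h (l + 1),
      HDer.bracket c.h k l K L =
          HDer.vins c.h K L - (-1 : ℝ) ^ (k * l) • HDer.vins c.h L K ∧
        HDer.bracket c.h k l K L ∈ HDer.equivariant c.h (k + l + 1) ∧
        HDer.IsDerH c.h k (HDer.ins c.h K) ∧ HDer.IsDerH c.h l (HDer.ins c.h L) ∧
        HDer.IsDerH c.h (k + l) (HDer.ins c.h (HDer.bracket c.h k l K L)) ∧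
        HDer.ins c.h (HDer.bracket c.h k l K L) =
          HDer.gradedComm k l (HDer.ins c.h K) (HDer.ins c.h L)) ∧
    HDer.IsGradedLieAlgebra (fun k => HDer.equivariant c.h (k + 1)) (HDer.bracket c.h) ∧
    -- 4. relations between `i(K)` and `h^*`
    (∀ (k : ℤ), ∀ K ∈ HDer.vformDeg E M (k + 1),
      (HDer.pull c.h ∘ₗ HDer.ins (HDer.BundleEnd.id E M) K =
          HDer.ins c.h (HDer.precomp c.h K) ∧
        HDer.ins c.h (HDer.precomp c.h K) = HDer.pull c.h ∘ₗ HDer.ins c.h K) ∧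
      (HDer.ins (HDer.BundleEnd.id E M) K ∘ₗ HDer.pull c.h =
          HDer.ins c.h (HDer.postcomp c.h K) ∧
        HDer.ins c.h (HDer.postcomp c.h K) = HDer.ins c.h K ∘ₗ HDer.pull c.h) ∧
      (HDer.ins (HDer.BundleEnd.id E M) K ∘ₗ HDer.pull c.h -
            HDer.pull c.h ∘ₗ HDer.ins (HDer.BundleEnd.id E M) K =
          HDer.ins c.h K ∘ₗ HDer.pull c.h - HDer.pull c.h ∘ₗ HDer.ins c.h K ∧
        HDer.ins c.h K ∘ₗ HDer.pull c.h - HDer.pull c.h ∘ₗ HDer.ins c.h K =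
          HDer.ins c.h (HDer.postcomp c.h K - HDer.precomp c.h K)) ∧
      (HDer.pull c.h ∘ₗ HDer.ins (HDer.BundleEnd.id E M) K ∘ₗ HDer.pull c.h =
          HDer.pull c.h ∘ₗ HDer.ins c.h K ∘ₗ HDer.pull c.h ∧
        HDer.pull c.h ∘ₗ HDer.ins c.h K ∘ₗ HDer.pull c.h =
          HDer.ins c.h (HDer.postcomp c.h (HDer.precomp c.h K)))) := by
  refine ⟨fun k D hD => ?_, fun k K hK D => ⟨fun h => ?_, ?_⟩, fun m q K α x X => ?_,
    fun k K _ => ?_,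
    fun k l K hK L hL => ⟨?_, ?_, ?_, ?_, ⟨?_, ?_⟩, ?_⟩, HDer.isGradedLieAlgebra_bracket c,
    fun k K _ => ⟨⟨?_, ?_⟩, ⟨?_, ?_⟩, ⟨?_, ?_⟩, ⟨?_, ?_⟩⟩⟩
  · obtain ⟨K, hK, hDK⟩ := hD.exists_vform
    refine ⟨K, ⟨hK, hDK⟩, fun L hL => ?_⟩
    refine sub_eq_zero.1 (HDer.eq_zero_of_oneFormComp fun α => ?_)
    rw [map_sub, ← hL.2, ← hDK, sub_self]
  · exact h.1.ext (HDer.ins_isAlgebraicDerivation c.h hK)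
      fun α => (h.2 α).trans (HDer.ins_oneForm c.h K α).symm
  · rintro rfl
    exact ⟨HDer.ins_isAlgebraicDerivation c.h hK, HDer.ins_oneForm c.h K⟩
  · rw [HDer.insTot_lof_succ, DirectSum.lof_apply]
    exact HDer.insAlt_apply _ _ _ _
  · exact HDer.ins_commutes_iff c.h c.h_idem K
  · rfl
  · exact HDer.bracket_mem_equivariant c hK hL
  · exact HDer.ins_isDerH c hK
  · exact HDer.ins_isDerH c hL
  · exact (HDer.ins_isDerH c (HDer.bracket_mem_equivariant c hK hL)).1
  · exact (HDer.ins_isDerH c (HDer.bracket_mem_equivariant c hK hL)).2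
  · exact HDer.ins_bracket c hK hL
  · exact HDer.pull_comp_ins_id c.h K
  · exact (HDer.pull_comp_ins c.h c.h_idem K).symm
  · exact HDer.ins_id_comp_pull c.h K
  · exact (HDer.ins_comp_pull c.h c.h_idem K).symm
  · rw [HDer.ins_id_comp_pull, HDer.pull_comp_ins_id, HDer.ins_comp_pull c.h c.h_idem,
      HDer.pull_comp_ins c.h c.h_idem]
  · exact HDer.ins_comp_pull_sub c.h c.h_idem K
  · rw [HDer.ins_id_comp_pull, HDer.ins_comp_pull c.h c.h_idem]
  · rw [← LinearMap.comp_assoc, HDer.pull_comp_ins c.h c.h_idem,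
      HDer.ins_comp_pull c.h c.h_idem]
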